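/- **Conventions.** A *model category* $\mathcal C$ means a pointed, complete and cocomplete, cofibrantly generated, proper model category in which (i) the projections $X\leftarrow X\times Y\to Y$ are always fibrations, (ii) the product $f\times g$ of two acyclic fibrations is a weak equivalence, and (iii) the coproduct $f\vee g$ of two acyclic cofibrations is a weak equivalence. For a based set $S$ and an object $X$ of $\mathcal C$, $X\otimes S=\bigvee_S X$ and $\prod_S X$ denote the coproduct and the product of copies of $X$, one for each element of $S$ other than the basepoint. Categories of functors into $\mathcal C$ have objectwise weak equivalences and fibrations. A model category $\mathcal C$ is *semi-stable* if * (Lower Triangular Axiom) whenever $A_1,A_2$ are cofibrant and $f\colon A_1\vee A_2\to A_1\times A_2$ has components $f_{ij}\colon A_i\to A_j$ with $f_{11},f_{22}$ weak equivalences and $f_{12}=0$, the map $f$ is a weak equivalence; * (Pushout-Product Coherence) the objectwise product of two homotopy pushout squares is a homotopy pushout square; * (Colimit-Product Coherence) for every ordinal $\lambda$ and all cofibrant $\lambda$-sequences $X,Y\colon\lambda\to\mathcal C$, the natural map $\mathrm{hocolim}(X\times Y)\to\mathrm{hocolim}(X)\times\mathrm{hocolim}(Y)$ is an isomorphism in $\mathrm{ho}(\mathcal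 C)$, where $\mathrm{hocolim}$ is the colimit of a cofibrant replacement. **Conjugate pairs.** An *indexing category* is a small category $\mathcal I$ with pullbacks in which every endomorphism is an isomorphism and each comma category $\mathcal I\downarrow a$ has a skeleton with finitely many objects. Let $\mathcal U$ be a small category with subcategories $\mathcal I,\mathcal A$ having the same objects as $\mathcal U$, where $\mathcal I$ is an indexing category, $\mathrm{Iso}(\mathcal I)\subseteq\mathrm{Iso}(\mathcal A)$, and every morphism of $\mathcal U$ is of the form $i\circ\alpha$ with $i\in\mathcal I$, $\alpha\in\mathcal A$. This factorization $\mathcal U=\mathcal I\circ\mathcal A$ *admits conjugation* if * whenever $i\circ\alpha=j\circ\beta$ with $\alpha\colon a\to b$, $\beta\colon a\to c$ in $\mathcal A$ and $i\colon b\to d$, $j\colon c\to d$ in $\mathcal I$, there is an isomorphism $\varphi\colon c\to b$ of $\mathcal I$ with $\varphi\beta=\alpha$ and $i\varphi=j$; * for $\alpha\colon a\to b$ in $\mathcal A$ and $i\colon c\to b$ in $\mathcal I$ there is a pullback square in $\mathcal U$ with projections $\alpha'\colon p\to c$ in $\mathcal A$ and $i'\colon p\to a$ in $\mathcal I$, and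 the natural isomorphism between any two such pullback squares is an isomorphism in $\mathcal I$. In that case let $\mathcal I\circ\mathcal A\circ\mathcal I^{\mathrm{op}}$ be the category with the objects of $\mathcal U$, whose morphisms $a\to b$ are the diagrams $a\xleftarrow{\,i\,}a_1\xrightarrow{\,\alpha\,}b_1\xrightarrow{\,j\,}b$ with $i,j\in\mathcal I$ and $\alpha\in\mathcal A$, written $j\circ\alpha\circ i^*$, two diagrams being identified if they are related by isomorphisms $a_1\cong a_2$ and $b_1\cong b_2$ of $\mathcal I$ compatible with all the maps. The composite of $j\circ\alpha\circ i^*\colon a\to b$, where $\alpha\colon w\to x$, with $l\circ\gamma\circ k^*\colon b\to c$, where $\gamma\colon y\to z$, is $(l j'')\circ(\gamma'\alpha')\circ(i k'')^*$. Here $k'\colon q\to x$, $j'\colon q\to y$ is a pullback of $j$ and $k$ in $\mathcal I$; $\alpha'\colon p\to q$ (in $\mathcal A$), $k''\colon p\to w$ (in $\mathcal I$) is a pullback of $k'$ and $\alpha$ in $\mathcal U$; and $\gamma\circ j'=j''\circ\gamma'$ with $j''\in\mathcal I$, $\gamma'\in\mathcal A$. A *conjugate pair* $(\mathcal B,\mathcal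 A)$ arising from $\mathcal U=\mathcal I\circ\mathcal A$ consists of $\mathcal A$ and a small category $\mathcal B$ equivalent to $\mathcal I\circ\mathcal A\circ\mathcal I^{\mathrm{op}}$. **The regular bimodule.** A map of $\mathcal I\circ\mathcal A\circ\mathcal I^{\mathrm{op}}$ is *regular* if it can be written $j\circ\alpha\circ 1^*$ with $j\in\mathcal I$, $\alpha\in\mathcal A$, and *singular* otherwise. Let $\mathcal U(a,b)_+$ be the set of maps $a\to b$ of $\mathcal I\circ\mathcal A\circ\mathcal I^{\mathrm{op}}$ with all singular maps collapsed to (and, if there are none, with an added) basepoint, i.e. the set of regular maps with a disjoint basepoint. Via $\gamma\mapsto\beta\circ\gamma\circ\alpha$ this is a functor $\mathcal U_+\colon\mathcal A^{\mathrm{op}}\times\mathcal B\to\mathrm{Sets}_*$ (for general $\mathcal B$, by restriction along the given equivalence). It induces an adjoint pair $\mathcal L\colon[\mathcal B^{\mathrm{op}},\mathcal C]\rightleftarrows[\mathcal A^{\mathrm{op}},\mathcal C]\colon\mathcal R$, $$\mathcal L F(a)=F\otimes_{\mathcal B}\mathcal U(a,-)_+=\int^{x\in\mathcal B}F(x)\otimes\mathcal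 U(a,x)_+,\qquad \mathcal R G(b)=\mathrm{Hom}^{\mathcal A}(\mathcal U(-,b)_+,G)=\int_{x\in\mathcal A}\prod_{\mathcal U(x,b)_+}G(x).$$ **Proposition.** Let $\mathcal C$ be a semi-stable model category and $(\mathcal B,\mathcal A)$ a conjugate pair. Let $b$ be an object of $\mathcal B$, let $C$ be a cofibrant object of $\mathcal C$, and let $F=F_b^C\colon\mathcal B^{\mathrm{op}}\to\mathcal C$ be the free functor $F(x)=C\otimes\mathcal B(x,b)_+$, where $\mathcal B(x,b)_+$ is $\mathcal B(x,b)$ with a disjoint basepoint. Then the unit $\eta_F\colon F\to\mathcal R(\mathcal L F)$ of the adjunction $\mathcal L\dashv\mathcal R$ is a weak equivalence, i.e. $\eta_F(x)\colon F(x)\to\mathcal R(\mathcal L F)(x)$ is a weak equivalence in $\mathcal C$ for every object $x$ of $\mathcal B$. -/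

import Mathlib

open CategoryTheory CategoryTheory.Limits HomotopicalAlgebra Opposite

universe v u

/-! ### Model categories and semi-stability -/

section ModelCategories

/-- The standing assumptions on a model category: `C` is cofibrantly generated, proper,
projections from binary products are fibrations, binary products of acyclic fibrations and binary
coproducts of acyclic cofibrations are weak equivalences.  (That `C` is pointed, complete and
cocomplete is expressed by the type class arguments.) -/
structure IsNiceModelCategory (C : Type u) [Category.{v} C] [ModelCategory C]
    [HasLimits C] [HasColimits C] [HasZeroObject C] : Prop where
  /-- There are sets of generating cofibrations and of generating acyclic cofibrations, both
  permitting the small object argument. -/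
  cofibrantly_generated : ∃ I J : MorphismProperty C,
    I.HasSmallObjectArgument.{v} ∧ J.HasSmallObjectArgument.{v} ∧
    trivialFibrations C = I.rlp ∧ fibrations C = J.rlp
  left_proper : ∀ {X Y Z P : C} (i : X ⟶ Y) (w : X ⟶ Z) (w' : Y ⟶ P) (i' : Z ⟶ P),
    IsPushout i w w' i' → Cofibration i → WeakEquivalence w → WeakEquivalence w'
  right_proper : ∀ {P X Y Z : C} (w' : P ⟶ X) (p' : P ⟶ Y) (p : X ⟶ Z) (w : Y ⟶ Z),
    IsPullback w' p' p w → Fibration p → WeakEquivalence w → WeakEquivalence w'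
  fibration_fst : ∀ X Y : C, Fibration (prod.fst : X ⨯ Y ⟶ X)
  fibration_snd : ∀ X Y : C, Fibration (prod.snd : X ⨯ Y ⟶ Y)
  prod_map : ∀ {A B X Y : C} (f : A ⟶ B) (g : X ⟶ Y), trivialFibrations C f →
    trivialFibrations C g → WeakEquivalence (prod.map f g)
  coprod_map : ∀ {A B X Y : C} (f : A ⟶ B) (g : X ⟶ Y), trivialCofibrations C f →
    trivialCofibrations C g → WeakEquivalence (coprod.map f g)

variable {C : Type u} [Category.{v} C] [ModelCategory C]

/-- The commutative square with sides `f : X ⟶ Y`, `g : X ⟶ Z`, `h : Y ⟶ P`, `k : Z ⟶ P` is a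
homotopy pushout: after replacing `f` and `g` by cofibrations, the map from the pushout to `P` is a
weak equivalence.  (In a left proper model category this does not depend on the replacements.) -/
def IsHomotopyPushout {X Y Z P : C} (f : X ⟶ Y) (g : X ⟶ Z) (h : Y ⟶ P) (k : Z ⟶ P) : Prop :=
  f ≫ h = g ≫ k ∧
  ∃ (Y' Z' W : C) (f' : X ⟶ Y') (p : Y' ⟶ Y) (g' : X ⟶ Z') (q : Z' ⟶ Z)
    (h' : Y' ⟶ W) (k' : Z' ⟶ W) (d : W ⟶ P),
    Cofibration f' ∧ WeakEquivalence p ∧ f' ≫ p = f ∧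
    Cofibration g' ∧ WeakEquivalence q ∧ g' ≫ q = g ∧
    IsPushout f' g' h' k' ∧ h' ≫ d = p ≫ h ∧ k' ≫ d = q ≫ k ∧ WeakEquivalence d

/-- A diagram is cofibrant for the model structure with objectwise weak equivalences and
fibrations: every map out of it lifts through every objectwise acyclic fibration. -/
def IsCofibrantDiagram {J : Type v} [SmallCategory J] (X : J ⥤ C) : Prop :=
  ∀ ⦃E B : J ⥤ C⦄ (p : E ⟶ B), (trivialFibrations C).functorCategory J p →
    ∀ f : X ⟶ B, ∃ g : X ⟶ E, g ≫ p = f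

/-- A cofibrant replacement of a diagram: an objectwise acyclic fibration from a cofibrant
diagram. -/
structure CofibrantReplacement {J : Type v} [SmallCategory J] (X : J ⥤ C) where
  obj : J ⥤ C
  cofibrant : IsCofibrantDiagram obj
  map : obj ⟶ X
  acyclic_fibration : (trivialFibrations C).functorCategory J map

/-- Semi-stable model categories.  In the last axiom, `hocolim` of a sequence is the colimit of a
cofibrant replacement, regarded as an object of the homotopy category `ho(C)` (the localization of
`C` at the weak equivalences), and the map induced by a map of sequences is represented by any lift
of it to cofibrant replacements; the natural map
`hocolim (X × Y) ⟶ hocolim X × hocolim Y` is an isomorphism if and only if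
`hocolim (X × Y)` with its two natural maps is a product in `ho(C)`. -/
structure IsSemiStable (C : Type u) [Category.{v} C] [ModelCategory C]
    [HasLimits C] [HasColimits C] [HasZeroObject C] [HasZeroMorphisms C] : Prop
    extends IsNiceModelCategory C where
  lower_triangular : ∀ (A₁ A₂ : C) [IsCofibrant A₁] [IsCofibrant A₂] (f : A₁ ⨿ A₂ ⟶ A₁ ⨯ A₂),
    WeakEquivalence (coprod.inl ≫ f ≫ prod.fst) → WeakEquivalence (coprod.inr ≫ f ≫ prod.snd) →
    coprod.inl ≫ f ≫ prod.snd = 0 → WeakEquivalence f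
  pushout_product : ∀ {X₁ Y₁ Z₁ P₁ X₂ Y₂ Z₂ P₂ : C}
    (f₁ : X₁ ⟶ Y₁) (g₁ : X₁ ⟶ Z₁) (h₁ : Y₁ ⟶ P₁) (k₁ : Z₁ ⟶ P₁)
    (f₂ : X₂ ⟶ Y₂) (g₂ : X₂ ⟶ Z₂) (h₂ : Y₂ ⟶ P₂) (k₂ : Z₂ ⟶ P₂),
    IsHomotopyPushout f₁ g₁ h₁ k₁ → IsHomotopyPushout f₂ g₂ h₂ k₂ →
    IsHomotopyPushout (prod.map f₁ f₂) (prod.map g₁ g₂) (prod.map h₁ h₂) (prod.map k₁ k₂)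
  colimit_product : ∀ (J : Type v) [LinearOrder J] [WellFoundedLT J] (X Y : J ⥤ C),
    IsCofibrantDiagram X → IsCofibrantDiagram Y →
    ∀ (QX : CofibrantReplacement X) (QY : CofibrantReplacement Y)
      (QXY : CofibrantReplacement (X ⨯ Y)) (f : QXY.obj ⟶ QX.obj) (g : QXY.obj ⟶ QY.obj),
      f ≫ QX.map = QXY.map ≫ prod.fst → g ≫ QY.map = QXY.map ≫ prod.snd →
      Nonempty (IsLimit (BinaryFan.mk ((weakEquivalences C).Q.map (colimMap f))
        ((weakEquivalences C).Q.map (colimMap g))))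

end ModelCategories

/-! ### Indexing categories, conjugation, and the category `I ∘ A ∘ Iᵒᵖ` -/

section Conjugation

/-- Indexing categories: small EI-categories with pullbacks such that each comma category
`K ↓ a` has a skeleton with finitely many objects. -/
structure IsIndexingCategory (K : Type v) [SmallCategory K] : Prop where
  ei : ∀ {x : K} (f : x ⟶ x), IsIso f
  pullbacks : HasPullbacks K
  finite : ∀ a : K, Finite (Skeleton (Over a))

variable {U : Type v} [SmallCategory U]

/-- `f` is an isomorphism in the wide subcategory of `U` with morphisms `I`. -/
def IsIsoIn (I : MorphismProperty U) {a b : U} (f : a ⟶ b) : Prop :=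
  I f ∧ ∃ g : b ⟶ a, I g ∧ f ≫ g = 𝟙 a ∧ g ≫ f = 𝟙 b

/-- `U` factors as `I ∘ A`, with `I` an indexing category and `Iso I ⊆ Iso A`, and the
factorization admits conjugation.  Subcategories with the same objects as `U` are given by
multiplicative classes of morphisms. -/
structure AdmitsConjugation (I A : MorphismProperty U) [I.IsMultiplicative]
    [A.IsMultiplicative] : Prop where
  indexing : IsIndexingCategory (WideSubcategory I)
  iso_le : ∀ {a b : U} (f : a ⟶ b), IsIsoIn I f → IsIsoIn A f
  factor : ∀ {a b : U} (f : a ⟶ b), ∃ (c : U) (α : a ⟶ c) (i : c ⟶ b), A α ∧ I i ∧ α ≫ i = f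
  lift : ∀ {a b c d : U} (α : a ⟶ b) (β : a ⟶ c) (i : b ⟶ d) (j : c ⟶ d),
    A α → A β → I i → I j → α ≫ i = β ≫ j →
    ∃ φ : c ⟶ b, IsIsoIn I φ ∧ β ≫ φ = α ∧ φ ≫ i = j
  pullback : ∀ {a b c : U} (α : a ⟶ b) (i : c ⟶ b), A α → I i →
    ∃ (p : U) (α' : p ⟶ c) (i' : p ⟶ a), A α' ∧ I i' ∧ IsPullback α' i' i α
  pullback_unique : ∀ {a b c p q : U} (α : a ⟶ b) (i : c ⟶ b) (α' : p ⟶ c) (i' : p ⟶ a)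
    (α'' : q ⟶ c) (i'' : q ⟶ a), A α → I i → A α' → I i' → A α'' → I i'' →
    IsPullback α' i' i α → IsPullback α'' i'' i α →
    ∀ θ : p ⟶ q, θ ≫ α'' = α' → θ ≫ i'' = i' → IsIsoIn I θ

/-- A map of `U` lying in `I`, as a map of the subcategory `I`. -/
def inSub {I : MorphismProperty U} [I.IsMultiplicative] {a b : U} (f : a ⟶ b) (hf : I f) :
    (⟨a⟩ : WideSubcategory I) ⟶ ⟨b⟩ :=
  InducedWideCategory.Hom.mk f hf

variable (I A : MorphismProperty U)

/-- Diagrams `a ←i- a₁ -α→ b₁ -j→ b` with `i, j ∈ I` and `α ∈ A`, representing `j ∘ α ∘ i*`. -/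
structure ThreeFold (a b : U) where
  a₁ : U
  b₁ : U
  i : a₁ ⟶ a
  α : a₁ ⟶ b₁
  j : b₁ ⟶ b
  hi : I i
  hα : A α
  hj : I j

variable {I A}

namespace IsIsoIn

lemma id [I.IsMultiplicative] (a : U) : IsIsoIn I (𝟙 a) :=
  ⟨I.id_mem a, 𝟙 a, I.id_mem a, by simp, by simp⟩

lemma comp [I.IsMultiplicative] {a b c : U} {f : a ⟶ b} {g : b ⟶ c} (hf : IsIsoIn I f)
    (hg : IsIsoIn I g) : IsIsoIn I (f ≫ g) := by
  obtain ⟨hf, f', hf', h₁, h₂⟩ := hf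
  obtain ⟨hg, g', hg', h₃, h₄⟩ := hg
  refine ⟨I.comp_mem _ _ hf hg, g' ≫ f', I.comp_mem _ _ hg' hf', ?_, ?_⟩
  · rw [Category.assoc, reassoc_of% h₃, h₁]
  · rw [Category.assoc, reassoc_of% h₂, h₄]

end IsIsoIn

namespace ThreeFold

/-- Two diagrams represent the same morphism if they are related by isomorphisms in `I`. -/
def Rel {a b : U} (f g : ThreeFold I A a b) : Prop :=
  ∃ (φ : f.a₁ ⟶ g.a₁) (ψ : f.b₁ ⟶ g.b₁), IsIsoIn I φ ∧ IsIsoIn I ψ ∧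
    φ ≫ g.i = f.i ∧ φ ≫ g.α = f.α ≫ ψ ∧ ψ ≫ g.j = f.j

variable [I.IsMultiplicative] [A.IsMultiplicative]

/-- The equivalence relation on three-fold diagrams. -/
def setoid (I A : MorphismProperty U) [I.IsMultiplicative] (a b : U) :
    Setoid (ThreeFold I A a b) where
  r := Rel
  iseqv := by
    refine ⟨fun f => ⟨𝟙 _, 𝟙 _, .id _, .id _, by simp, by simp, by simp⟩, ?_, ?_⟩
    · rintro f g ⟨φ, ψ, ⟨hφ, φ', hφ', h₁, h₂⟩, ⟨hψ, ψ', hψ', h₃, h₄⟩, h₅, h₆, h₇⟩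
      refine ⟨φ', ψ', ⟨hφ', φ, hφ, h₂, h₁⟩, ⟨hψ', ψ, hψ, h₄, h₃⟩, ?_, ?_, ?_⟩
      · rw [← h₅, reassoc_of% h₂]
      · have := φ' ≫= h₆ =≫ ψ'
        simp only [Category.assoc, h₃, Category.comp_id, reassoc_of% h₂] at this
        exact this.symm
      · rw [← h₇, reassoc_of% h₄]
    · rintro f g h ⟨φ, ψ, hφ, hψ, h₁, h₂, h₃⟩ ⟨φ', ψ', hφ', hψ', h₄, h₅, h₆⟩
      refine ⟨φ ≫ φ', ψ ≫ ψ', hφ.comp hφ', hψ.comp hψ', ?_, ?_, ?_⟩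
      · rw [Category.assoc, h₄, h₁]
      · rw [Category.assoc, h₅, reassoc_of% h₂]
      · rw [Category.assoc, h₆, h₃]

/-- The diagram defining a composite of `a ←i- w -α→ x -j→ b` and `b ←k- y -γ→ z -l→ c`:
a pullback `q` of `j` along `k` in `I`, a pullback `p` (in `U`) of `α` along `k'`, and a
factorization of `γ ∘ j'`. -/
structure Composition {a b c : U} (f : ThreeFold I A a b) (g : ThreeFold I A b c) where
  p : U
  q : U
  r : U
  k' : q ⟶ f.b₁
  j' : q ⟶ g.a₁
  hk' : I k'
  hj' : I j'
  isPullback : IsPullback (inSub j' hj') (inSub k' hk') (inSub g.i g.hi) (inSub f.j f.hj)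
  α' : p ⟶ q
  k'' : p ⟶ f.a₁
  hα' : A α'
  hk'' : I k''
  isPullback' : IsPullback α' k'' k' f.α
  γ' : q ⟶ r
  j'' : r ⟶ g.b₁
  hγ' : A γ'
  hj'' : I j''
  fac : γ' ≫ j'' = j' ≫ g.α

/-- The composite `(l j'') ∘ (γ' α') ∘ (i k'')*`. -/
abbrev Composition.comp {a b c : U} {f : ThreeFold I A a b} {g : ThreeFold I A b c}
    (s : Composition f g) : ThreeFold I A a c where
  a₁ := s.p
  b₁ := s.r
  i := s.k'' ≫ f.i
  α := s.α' ≫ s.γ'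
  j := s.j'' ≫ g.j
  hi := I.comp_mem _ _ s.hk'' f.hi
  hα := A.comp_mem _ _ s.hα' s.hγ'
  hj := I.comp_mem _ _ s.hj'' g.hj

/-- The map `j ∘ α` in `U`. -/
abbrev u {a b : U} (f : ThreeFold I A a b) : f.a₁ ⟶ b := f.α ≫ f.j

lemma Composition.comp_u {a b c : U} {f : ThreeFold I A a b} {g : ThreeFold I A b c}
    (s : Composition f g) : s.comp.u = (s.α' ≫ s.j') ≫ g.u := by
  simp only [ThreeFold.u, Category.assoc, reassoc_of% s.fac]

/-- The diagram `a ←1- a -α→ b₁ -j→ b` of a map `j ∘ α` of `U`. -/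
abbrev regular {a b₁ b : U} (α : a ⟶ b₁) (j : b₁ ⟶ b) (hα : A α) (hj : I j) :
    ThreeFold I A a b where
  a₁ := a
  b₁ := b₁
  i := 𝟙 a
  α := α
  j := j
  hi := I.id_mem a
  hα := hα
  hj := hj

end ThreeFold

variable [I.IsMultiplicative] [A.IsMultiplicative]

namespace AdmitsConjugation

lemma ei (h : AdmitsConjugation I A) {a : U} {f : a ⟶ a} (hf : I f) : IsIsoIn I f := by
  have := h.indexing.ei (x := (⟨a⟩ : WideSubcategory I)) ⟨f, hf⟩
  obtain ⟨g, h₁, h₂⟩ := this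
  exact ⟨hf, g.hom, g.property, congr($(h₁).hom), congr($(h₂).hom)⟩

/-- A retract in `I` is an isomorphism. -/
lemma isIsoIn_of_section (h : AdmitsConjugation I A) {a b : U} {s : a ⟶ b} {f : b ⟶ a} (hs : I s) (hf : I f)
    (e : s ≫ f = 𝟙 a) : IsIsoIn I f := by
  obtain ⟨_, g, hg, h₁, h₂⟩ := h.ei (I.comp_mem _ _ hf hs)
  rw [Category.assoc] at h₁
  have : s = s ≫ g ≫ f ≫ s := by rw [h₂, Category.comp_id]
  refine ⟨hf, s ≫ g, I.comp_mem _ _ hs hg, h₁, ?_⟩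
  have h₃ : f ≫ s ≫ g = g ≫ f ≫ s := by rw [h₁, h₂]
  calc (s ≫ g) ≫ f = (s ≫ g) ≫ f ≫ s ≫ f := by rw [e, Category.comp_id]
    _ = s ≫ (g ≫ f ≫ s) ≫ f := by simp only [Category.assoc]
    _ = 𝟙 a := by rw [h₂, Category.id_comp, e]

/-- Every map of `I` is monic in `I`. -/
lemma mono_in (h : AdmitsConjugation I A) {a b c : U} {f g : a ⟶ b} {i : b ⟶ c} (hf : I f) (hg : I g) (hi : I i)
    (e : f ≫ i = g ≫ i) : f = g := by
  have := h.indexing.pullbacks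
  let i' : (⟨b⟩ : WideSubcategory I) ⟶ ⟨c⟩ := ⟨i, hi⟩
  have sq := IsPullback.of_hasPullback i' i'
  let Δ := sq.lift (𝟙 _) (𝟙 _) rfl
  have h₁ : Δ ≫ pullback.fst i' i' = 𝟙 _ := sq.lift_fst _ _ _
  have h₂ : Δ ≫ pullback.snd i' i' = 𝟙 _ := sq.lift_snd _ _ _
  have h₃ : IsIsoIn I (pullback.fst i' i').hom :=
    h.isIsoIn_of_section Δ.property (pullback.fst i' i').property congr($(h₁).hom)
  obtain ⟨-, r, hr, h₄, h₅⟩ := h₃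
  have h₆ : Δ.hom ≫ (pullback.fst i' i').hom = 𝟙 _ := congr($(h₁).hom)
  have h₇ : Δ.hom ≫ (pullback.snd i' i').hom = 𝟙 _ := congr($(h₂).hom)
  have h₈ : (pullback.fst i' i').hom ≫ Δ.hom = 𝟙 _ := by
    have : Δ.hom = r := by
      calc Δ.hom = Δ.hom ≫ (pullback.fst i' i').hom ≫ r := by rw [h₄, Category.comp_id]
        _ = r := by rw [reassoc_of% h₆]
    rw [this, h₄]
  have h₉ : (pullback.fst i' i').hom = (pullback.snd i' i').hom := by
    rw [← Category.comp_id (pullback.fst i' i').hom, ← h₇, reassoc_of% h₈]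
  obtain ⟨m, e₁, e₂⟩ := sq.exists_lift (inSub f hf) (inSub g hg) (WideSubcategory.hom_ext _ e)
  have e₁ : m.hom ≫ (pullback.fst i' i').hom = f := congr($(e₁).hom)
  have e₂ : m.hom ≫ (pullback.snd i' i').hom = g := congr($(e₂).hom)
  rw [← e₁, ← e₂, h₉]

/-- Every map of `I` is monic in `U`. -/
lemma mono (h : AdmitsConjugation I A) {a b c : U} {f g : a ⟶ b} {i : b ⟶ c} (hi : I i)
    (e : f ≫ i = g ≫ i) : f = g := by
  obtain ⟨x, α, k, hα, hk, rfl⟩ := h.factor f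
  obtain ⟨y, β, l, hβ, hl, rfl⟩ := h.factor g
  simp only [Category.assoc] at e
  obtain ⟨φ, hφ, h₁, h₂⟩ := h.lift α β (k ≫ i) (l ≫ i) hα hβ (I.comp_mem _ _ hk hi)
    (I.comp_mem _ _ hl hi) e
  have : φ ≫ k = l := h.mono_in (I.comp_mem _ _ hφ.1 hk) hl hi (by simpa using h₂)
  rw [← h₁, Category.assoc, this]

/-- `I` is left cancellable in `U`. -/
lemma of_comp (h : AdmitsConjugation I A) {a b c : U} {θ : a ⟶ b} {k : b ⟶ c} (hk : I k) (hθ : I (θ ≫ k)) : I θ := by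
  obtain ⟨x, α, l, hα, hl, rfl⟩ := h.factor θ
  obtain ⟨φ, hφ, h₁, h₂⟩ := h.lift (𝟙 a) α ((α ≫ l) ≫ k) (l ≫ k) (A.id_mem a) hα hθ
    (I.comp_mem _ _ hl hk) (by simp)
  obtain ⟨hφ, φ', hφ', h₃, h₄⟩ := hφ
  have : α = φ' := by
    calc α = α ≫ φ ≫ φ' := by rw [h₃, Category.comp_id]
      _ = φ' := by rw [reassoc_of% h₁]
  exact I.comp_mem _ _ (this ▸ hφ') hl

/-- A pullback square of maps in `I` is a pullback square in `U`. -/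
lemma isPullback_of_in (h : AdmitsConjugation I A) {p x y b : U} {l : p ⟶ y} {k : p ⟶ x} {m : y ⟶ b} {j : x ⟶ b}
    (hl : I l) (hk : I k) (hm : I m) (hj : I j)
    (sq : IsPullback (inSub l hl) (inSub k hk) (inSub m hm) (inSub j hj)) :
    IsPullback l k m j := by
  have key : ∀ s : PullbackCone m j, ∃ n : s.pt ⟶ p, n ≫ l = s.fst ∧ n ≫ k = s.snd := by
    intro s
    obtain ⟨c, α, f, hα, hf, e₁⟩ := h.factor s.fst
    obtain ⟨d, β, g, hβ, hg, e₂⟩ := h.factor s.snd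
    have e := s.condition
    rw [← e₁, ← e₂, Category.assoc, Category.assoc] at e
    obtain ⟨φ, hφ, h₁, h₂⟩ := h.lift α β (f ≫ m) (g ≫ j) hα hβ (I.comp_mem _ _ hf hm)
      (I.comp_mem _ _ hg hj) e
    obtain ⟨n, e₃, e₄⟩ := sq.exists_lift (inSub (φ ≫ f) (I.comp_mem _ _ hφ.1 hf)) (inSub g hg)
      (WideSubcategory.hom_ext _ (by simpa [inSub] using h₂))
    have e₃ : n.hom ≫ l = φ ≫ f := congr($(e₃).hom)
    have e₄ : n.hom ≫ k = g := congr($(e₄).hom)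
    exact ⟨β ≫ n.hom, by rw [Category.assoc, e₃, reassoc_of% h₁, e₁],
      by rw [Category.assoc, e₄, e₂]⟩
  choose n hn₁ hn₂ using key
  exact ⟨⟨congr($(sq.w).hom)⟩, ⟨PullbackCone.IsLimit.mk _ n hn₁ hn₂
    (fun s t h₁ h₂ => h.mono hl (h₁.trans (hn₁ s).symm))⟩⟩

/-- Two pullbacks of the same maps of `U` along the same map of `I` differ by an isomorphism
in `I`. -/
lemma pullback_iso (h : AdmitsConjugation I A) {p p' w y b : U} {v : p ⟶ y} {k : p ⟶ w} {v' : p' ⟶ y} {k' : p' ⟶ w}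
    {m : y ⟶ b} {u : w ⟶ b} (s : IsPullback v k m u) (s' : IsPullback v' k' m u)
    (hk : I k) (hk' : I k') :
    ∃ θ : p ⟶ p', IsIsoIn I θ ∧ θ ≫ k' = k ∧ θ ≫ v' = v := by
  let θ := s'.lift v k s.w
  let θ' := s.lift v' k' s'.w
  have h₁ : θ ≫ k' = k := s'.lift_snd _ _ _
  have h₂ : θ ≫ v' = v := s'.lift_fst _ _ _
  have h₃ : θ' ≫ k = k' := s.lift_snd _ _ _
  have h₄ : θ' ≫ v = v' := s.lift_fst _ _ _
  exact ⟨θ, ⟨h.of_comp hk' (by rwa [h₁]), θ', h.of_comp hk (by rwa [h₃]),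
    s.hom_ext (by simp [h₂, h₄]) (by simp [h₁, h₃]),
    s'.hom_ext (by simp [h₂, h₄]) (by simp [h₁, h₃])⟩, h₁, h₂⟩

lemma rel_of (h : AdmitsConjugation I A) {a b : U} {f g : ThreeFold I A a b} (φ : f.a₁ ⟶ g.a₁) (hφ : IsIsoIn I φ)
    (h₁ : φ ≫ g.i = f.i) (h₂ : φ ≫ g.u = f.u) : ThreeFold.Rel f g := by
  obtain ⟨ψ, hψ, h₃, h₄⟩ := h.lift (φ ≫ g.α) f.α g.j f.j
    (A.comp_mem _ _ (h.iso_le _ hφ).1 g.hα) f.hα g.hj f.hj (by simpa using h₂)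
  exact ⟨φ, ψ, hφ, hψ, h₁, h₃.symm, h₄⟩

lemma exists_composition (h : AdmitsConjugation I A) {a b c : U} (f : ThreeFold I A a b) (g : ThreeFold I A b c) :
    Nonempty (ThreeFold.Composition f g) := by
  have := h.indexing.pullbacks
  have sq := IsPullback.of_hasPullback (inSub g.i g.hi) (inSub f.j f.hj)
  obtain ⟨p, α', k'', hα', hk'', sq'⟩ := h.pullback f.α
    (pullback.snd (inSub g.i g.hi) (inSub f.j f.hj)).hom f.hα
    (pullback.snd (inSub g.i g.hi) (inSub f.j f.hj)).property
  obtain ⟨r, γ', j'', hγ', hj'', fac⟩ := h.factor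
    ((pullback.fst (inSub g.i g.hi) (inSub f.j f.hj)).hom ≫ g.α)
  exact ⟨{
    p := p
    q := (Limits.pullback (inSub g.i g.hi) (inSub f.j f.hj)).obj
    r := r
    k' := (pullback.snd (inSub g.i g.hi) (inSub f.j f.hj)).hom
    j' := (pullback.fst (inSub g.i g.hi) (inSub f.j f.hj)).hom
    hk' := (pullback.snd (inSub g.i g.hi) (inSub f.j f.hj)).property
    hj' := (pullback.fst (inSub g.i g.hi) (inSub f.j f.hj)).property
    isPullback := sq
    α' := α'
    k'' := k''
    hα' := hα'
    hk'' := hk''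
    isPullback' := sq'
    γ' := γ'
    j'' := j''
    hγ' := hγ'
    hj'' := hj''
    fac := fac }⟩

lemma composition_isPullback (h : AdmitsConjugation I A) {a b c : U} {f : ThreeFold I A a b} {g : ThreeFold I A b c}
    (s : ThreeFold.Composition f g) : IsPullback (s.α' ≫ s.j') s.k'' g.i f.u :=
  s.isPullback'.paste_horiz (h.isPullback_of_in s.hj' s.hk' g.hi f.hj s.isPullback)

/-- Composites are well defined up to equivalence. -/
lemma composition_rel (h : AdmitsConjugation I A) {a b c : U} {f f' : ThreeFold I A a b} {g g' : ThreeFold I A b c}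
    (hf : ThreeFold.Rel f f') (hg : ThreeFold.Rel g g')
    (s : ThreeFold.Composition f g) (s' : ThreeFold.Composition f' g') :
    ThreeFold.Rel s.comp s'.comp := by
  obtain ⟨φ, φ₂, hφ, -, e₁, e₂, e₃⟩ := hf
  obtain ⟨ψ, ψ₂, hψ, -, e₄, e₅, e₆⟩ := hg
  have eu : φ ≫ f'.u = f.u := by rw [reassoc_of% e₂, e₃]
  have ev : ψ ≫ g'.u = g.u := by rw [reassoc_of% e₅, e₆]
  have : IsIso φ := ⟨hφ.2.choose, hφ.2.choose_spec.2⟩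
  have : IsIso ψ := ⟨hψ.2.choose, hψ.2.choose_spec.2⟩
  have t : IsPullback ((s.α' ≫ s.j') ≫ ψ) (s.k'' ≫ φ) g'.i f'.u :=
    (h.composition_isPullback s).of_iso (Iso.refl _) (asIso ψ) (asIso φ) (Iso.refl _)
      (by simp) (by simp) (by simpa using e₄.symm) (by simpa using eu.symm)
  obtain ⟨θ, hθ, h₁, h₂⟩ := h.pullback_iso t (h.composition_isPullback s')
    (I.comp_mem _ _ s.hk'' hφ.1) s'.hk''
  refine h.rel_of θ hθ ?_ ?_
  · rw [reassoc_of% h₁, e₁]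
  · rw [ThreeFold.Composition.comp_u, ThreeFold.Composition.comp_u, ← ev,
      ← Category.assoc, h₂, Category.assoc]

end AdmitsConjugation

/-- The objects of the category `I ∘ A ∘ Iᵒᵖ` are those of `U`. -/
structure ConjCat {I A : MorphismProperty U} [I.IsMultiplicative] [A.IsMultiplicative]
    (h : AdmitsConjugation I A) where
  obj : U

namespace ConjCat

variable {h : AdmitsConjugation I A}

/-- The morphisms of `I ∘ A ∘ Iᵒᵖ` are equivalence classes of three-fold diagrams. -/
def Hom (a b : ConjCat h) : Type v := Quotient (ThreeFold.setoid I A a.obj b.obj)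

/-- The class of a three-fold diagram. -/
def Hom.mk {a b : ConjCat h} (f : ThreeFold I A a.obj b.obj) : Hom a b :=
  Quotient.mk (ThreeFold.setoid I A a.obj b.obj) f

/-- Composition of classes of three-fold diagrams. -/
noncomputable def Hom.comp {a b c : ConjCat h} (f : Hom a b) (g : Hom b c) : Hom a c :=
  Quotient.map₂ (sa := ThreeFold.setoid I A a.obj b.obj) (sb := ThreeFold.setoid I A b.obj c.obj)
    (sc := ThreeFold.setoid I A a.obj c.obj)
    (fun f g => (Classical.choice (h.exists_composition f g)).comp)
    (fun _ _ hf _ _ hg => h.composition_rel hf hg _ _) f g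

noncomputable instance : CategoryStruct (ConjCat h) where
  Hom := Hom
  id a := Hom.mk (ThreeFold.regular (𝟙 a.obj) (𝟙 a.obj) (A.id_mem _) (I.id_mem _))
  comp := Hom.comp

/-- The morphism of `I ∘ A ∘ Iᵒᵖ` represented by a three-fold diagram. -/
def homMk {a b : ConjCat h} (f : ThreeFold I A a.obj b.obj) : a ⟶ b := Hom.mk f

lemma homMk_surjective {a b : ConjCat h} (β : a ⟶ b) : ∃ f, homMk f = β :=
  Quotient.exists_rep (s := ThreeFold.setoid I A a.obj b.obj) β

lemma homMk_eq_iff {a b : ConjCat h} (f g : ThreeFold I A a.obj b.obj) :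
    (homMk f : a ⟶ b) = homMk g ↔ ThreeFold.Rel f g :=
  Quotient.eq (r := ThreeFold.setoid I A a.obj b.obj)

lemma id_eq (a : ConjCat h) : 𝟙 a =
    homMk (ThreeFold.regular (𝟙 a.obj) (𝟙 a.obj) (A.id_mem _) (I.id_mem _)) := rfl

/-- Any choice of the diagram defining a composite represents the composite. -/
lemma homMk_comp {a b c : ConjCat h} {f : ThreeFold I A a.obj b.obj}
    {g : ThreeFold I A b.obj c.obj} (s : ThreeFold.Composition f g) :
    (homMk f : a ⟶ b) ≫ (homMk g : b ⟶ c) = homMk s.comp :=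
  (homMk_eq_iff _ _).2 (h.composition_rel ((ThreeFold.setoid I A _ _).refl f)
    ((ThreeFold.setoid I A _ _).refl g) _ s)

/-- Composites computed by means of pullbacks in `U`. -/
lemma homMk_comp_of {a b c : ConjCat h} {f : ThreeFold I A a.obj b.obj}
    {g : ThreeFold I A b.obj c.obj} {r : ThreeFold I A a.obj c.obj}
    (v : r.a₁ ⟶ g.a₁) (k : r.a₁ ⟶ f.a₁) (s : IsPullback v k g.i f.u) (hk : I k)
    (hi : r.i = k ≫ f.i) (hu : r.u = v ≫ g.u) :
    (homMk f : a ⟶ b) ≫ (homMk g : b ⟶ c) = homMk r := by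
  obtain ⟨t⟩ := h.exists_composition f g
  rw [homMk_comp t, homMk_eq_iff]
  obtain ⟨θ, hθ, h₁, h₂⟩ := h.pullback_iso (h.composition_isPullback t) s t.hk'' hk
  refine h.rel_of θ hθ ?_ ?_
  · rw [hi, reassoc_of% h₁]
  · rw [hu, reassoc_of% h₂, ThreeFold.Composition.comp_u, Category.assoc]

noncomputable instance : Category.{v} (ConjCat h) where
  id_comp {a b} f := by
    obtain ⟨f, rfl⟩ := homMk_surjective f
    rw [id_eq]
    refine homMk_comp_of (r := f) (𝟙 _) f.i ?_ f.hi (by simp) (by simp)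
    exact IsPullback.of_horiz_isIso ⟨by simp [ThreeFold.u]⟩
  comp_id {a b} f := by
    obtain ⟨f, rfl⟩ := homMk_surjective f
    rw [id_eq]
    refine homMk_comp_of (r := f) f.u (𝟙 _) ?_ (I.id_mem _) (by simp) (by simp [ThreeFold.u])
    exact IsPullback.of_vert_isIso ⟨by simp⟩
  assoc {a b c d} f g k := by
    obtain ⟨f, rfl⟩ := homMk_surjective f
    obtain ⟨g, rfl⟩ := homMk_surjective g
    obtain ⟨k, rfl⟩ := homMk_surjective k
    obtain ⟨s⟩ := h.exists_composition f g
    obtain ⟨t⟩ := h.exists_composition g k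
    rw [homMk_comp s, homMk_comp t]
    obtain ⟨r⟩ := h.exists_composition s.comp k
    rw [homMk_comp r]
    have hs := h.composition_isPullback s
    have ht := h.composition_isPullback t
    have hr := h.composition_isPullback r
    let w := ht.lift (r.α' ≫ r.j') (r.k'' ≫ s.α' ≫ s.j') (by
      rw [hr.w, ThreeFold.Composition.comp_u]; simp)
    have w₁ : w ≫ t.α' ≫ t.j' = r.α' ≫ r.j' := ht.lift_fst _ _ _
    have w₂ : w ≫ t.k'' = r.k'' ≫ s.α' ≫ s.j' := ht.lift_snd _ _ _
    have hw : IsPullback w r.k'' t.k'' (s.α' ≫ s.j') := by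
      refine IsPullback.of_right ?_ w₂ ht
      rw [w₁, ← ThreeFold.Composition.comp_u]
      exact hr
    symm
    refine homMk_comp_of (r := r.comp) w (r.k'' ≫ s.k'') (hw.paste_vert hs)
      (I.comp_mem _ _ r.hk'' s.hk'') (by simp) ?_
    rw [ThreeFold.Composition.comp_u, ThreeFold.Composition.comp_u, ← w₁]
    simp only [Category.assoc]

/-- The inclusion of `A` as a subcategory of `I ∘ A ∘ Iᵒᵖ`. -/
noncomputable def inclA (h : AdmitsConjugation I A) : WideSubcategory A ⥤ ConjCat h where
  obj a := ⟨a.obj⟩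
  map α := homMk (ThreeFold.regular α.hom (𝟙 _) α.property (I.id_mem _))
  map_id a := rfl
  map_comp {a b c} α β := by
    symm
    refine homMk_comp_of (a := ⟨a.obj⟩) (b := ⟨b.obj⟩) (c := ⟨c.obj⟩) α.hom (𝟙 _) ?_
      (I.id_mem _) (by simp) (by simp [ThreeFold.u])
    exact IsPullback.of_vert_isIso ⟨by simp [ThreeFold.u]⟩

/-- The regular maps: those of the subcategory `U = I ∘ A`.  The other maps are singular. -/
def IsRegular {a b : ConjCat h} (β : a ⟶ b) : Prop :=
  ∃ (b₁ : U) (α : a.obj ⟶ b₁) (j : b₁ ⟶ b.obj) (hα : A α) (hj : I j),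
    β = homMk (ThreeFold.regular α j hα hj)

lemma isRegular_homMk_iff {a b : ConjCat h} (f : ThreeFold I A a.obj b.obj) :
    IsRegular (homMk f : a ⟶ b) ↔ IsIsoIn I f.i := by
  constructor
  · rintro ⟨b₁, α, j, hα, hj, e⟩
    obtain ⟨φ, ψ, hφ, -, h₁, -, -⟩ := (homMk_eq_iff _ _).1 e
    rw [← h₁]
    exact hφ.comp (.id _)
  · rintro ⟨hi, i', hi', h₁, h₂⟩
    refine ⟨f.b₁, i' ≫ f.α, f.j, A.comp_mem _ _ (h.iso_le i' ⟨hi', f.i, hi, h₂, h₁⟩).1 f.hα,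
      f.hj, ?_⟩
    rw [homMk_eq_iff]
    exact h.rel_of f.i ⟨hi, i', hi', h₁, h₂⟩ (by simp) (by simp [ThreeFold.u, reassoc_of% h₁])

lemma isRegular_of_comp {a b c : ConjCat h} (σ : a ⟶ b) (β : b ⟶ c) (H : IsRegular (σ ≫ β)) :
    IsRegular σ := by
  obtain ⟨f, rfl⟩ := homMk_surjective σ
  obtain ⟨g, rfl⟩ := homMk_surjective β
  obtain ⟨s⟩ := h.exists_composition f g
  rw [homMk_comp s, isRegular_homMk_iff] at H
  obtain ⟨-, r, hr, -, h₂⟩ := H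
  rw [isRegular_homMk_iff]
  refine h.isIsoIn_of_section (I.comp_mem _ _ hr s.hk'') f.hi ?_
  simpa using h₂

lemma isRegular_of_homMk_comp {a b : U} {c : ConjCat h} (α : a ⟶ b) (hα : A α)
    (γ : (⟨b⟩ : ConjCat h) ⟶ c)
    (H : IsRegular ((homMk (ThreeFold.regular α (𝟙 _) hα (I.id_mem _)) :
      (⟨a⟩ : ConjCat h) ⟶ ⟨b⟩) ≫ γ)) : IsRegular γ := by
  obtain ⟨g, rfl⟩ := homMk_surjective γ
  obtain ⟨p, α', k, hα', hk, sq⟩ := h.pullback α g.i hα g.hi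
  obtain ⟨r, β, l, hβ, hl, e⟩ := h.factor (α' ≫ g.α)
  rw [homMk_comp_of (r :=
      { a₁ := p, b₁ := r, i := k, α := β, j := l ≫ g.j, hi := hk, hα := hβ,
        hj := I.comp_mem _ _ hl g.hj }) α' k (by simpa [ThreeFold.u] using sq) hk (by simp)
      (by simp [ThreeFold.u, reassoc_of% e]), isRegular_homMk_iff] at H
  obtain ⟨-, k', hk', h₁, h₂⟩ := H
  dsimp only at k' hk' h₁ h₂
  obtain ⟨φ, hφ, h₃, h₄⟩ := h.lift (k' ≫ α') α g.i (𝟙 _)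
    (A.comp_mem _ _ (h.iso_le k' ⟨hk', k, hk, h₂, h₁⟩).1 hα') hα g.hi (I.id_mem _)
    (by rw [Category.assoc, sq.w, reassoc_of% h₂, Category.comp_id])
  rw [isRegular_homMk_iff]
  exact h.isIsoIn_of_section hφ.1 g.hi h₄

lemma isRegular_of_inclA_comp {a b : WideSubcategory A} {c : ConjCat h} (α : a ⟶ b)
    (γ : (inclA h).obj b ⟶ c) (H : IsRegular ((inclA h).map α ≫ γ)) : IsRegular γ :=
  isRegular_of_homMk_comp α.hom α.property γ H

/-- The based set `U(a, b)₊ = B(a, b) / S(a, b)`, where `B = I ∘ A ∘ Iᵒᵖ` and `S(a, b)` is the set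
of singular maps: the regular maps together with a disjoint basepoint `none`. -/
abbrev RegularSet (a b : ConjCat h) : Pointed.{v} :=
  Pointed.of (none : Option {γ : a ⟶ b // IsRegular γ})

open Classical in
/-- The quotient map `B(a, b) ⟶ U(a, b)₊`, sending singular maps to the basepoint. -/
noncomputable def toRegularSet {a b : ConjCat h} (γ : a ⟶ b) : RegularSet a b :=
  if hγ : IsRegular γ then some ⟨γ, hγ⟩ else none

lemma toRegularSet_of_regular {a b : ConjCat h} (γ : {γ : a ⟶ b // IsRegular γ}) :
    toRegularSet γ.1 = (some γ : Option _) := dif_pos γ.2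

lemma toRegularSet_of_not {a b : ConjCat h} {γ : a ⟶ b} (hγ : ¬ IsRegular γ) :
    toRegularSet γ = (none : Option _) := dif_neg hγ

/-- The map `U(a, b)₊ ⟶ U(a', b')₊` induced by `γ ↦ β ∘ γ ∘ α`. -/
noncomputable def regularMap {a a' : WideSubcategory A} {b b' : ConjCat h} (α : a' ⟶ a)
    (β : b ⟶ b') :
    RegularSet ((inclA h).obj a) b ⟶ RegularSet ((inclA h).obj a') b' where
  toFun x := Option.elim x none (fun γ => toRegularSet ((inclA h).map α ≫ γ.1 ≫ β))
  map_point := rfl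

lemma regularMap_toRegularSet {a a' : WideSubcategory A} {b b' : ConjCat h} (α : a' ⟶ a)
    (β : b ⟶ b') (γ : (inclA h).obj a ⟶ b) :
    (regularMap α β).toFun (toRegularSet γ) = toRegularSet ((inclA h).map α ≫ γ ≫ β) := by
  by_cases hγ : IsRegular γ
  · exact congrArg (regularMap α β).toFun (toRegularSet_of_regular ⟨γ, hγ⟩)
  · rw [toRegularSet_of_not hγ, toRegularSet_of_not]
    · rfl
    · exact fun H => hγ (isRegular_of_comp _ _ (isRegular_of_inclA_comp _ _ H))

lemma regularHom_ext {a a' : WideSubcategory A} {b b' : ConjCat h}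
    {F G : RegularSet ((inclA h).obj a) b ⟶ RegularSet ((inclA h).obj a') b'}
    (H : ∀ γ, F.toFun (toRegularSet γ) = G.toFun (toRegularSet γ)) : F = G := by
  apply Pointed.Hom.ext
  funext x
  obtain _ | γ := x
  · exact F.map_point.trans G.map_point.symm
  · rw [← toRegularSet_of_regular γ]
    exact H _

lemma regularMap_id (a : WideSubcategory A) (b : ConjCat h) :
    regularMap (𝟙 a) (𝟙 b) = 𝟙 (RegularSet ((inclA h).obj a) b) :=
  regularHom_ext fun γ => by
    rw [regularMap_toRegularSet, CategoryTheory.Functor.map_id, Category.id_comp, Category.comp_id]; rfl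

lemma regularMap_comp {a a' a'' : WideSubcategory A} {b b' b'' : ConjCat h} (α : a' ⟶ a)
    (α' : a'' ⟶ a') (β : b ⟶ b') (β' : b' ⟶ b'') :
    regularMap α β ≫ regularMap α' β' = regularMap (α' ≫ α) (β ≫ β') :=
  regularHom_ext fun γ => by
    rw [Pointed.Hom.comp_toFun', Function.comp_apply, regularMap_toRegularSet,
      regularMap_toRegularSet, regularMap_toRegularSet]
    simp only [CategoryTheory.Functor.map_comp, Category.assoc]

/-- The regular bimodule `U₊ : Aᵒᵖ × B ⥤ Sets_*` for `B = I ∘ A ∘ Iᵒᵖ`, in curried form. -/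
noncomputable def regularBimodule (h : AdmitsConjugation I A) :
    (WideSubcategory A)ᵒᵖ ⥤ ConjCat h ⥤ Pointed.{v} where
  obj a :=
    { obj := fun b => RegularSet ((inclA h).obj a.unop) b
      map := fun β => regularMap (𝟙 _) β
      map_id := fun b => regularMap_id _ _
      map_comp := fun β β' => by rw [regularMap_comp, Category.comp_id] }
  map α :=
    { app := fun b => regularMap α.unop (𝟙 b)
      naturality := fun b b' β =>
        ((regularMap_comp _ _ _ _).trans (by simp only [Category.comp_id, Category.id_comp])).trans
          (regularMap_comp _ _ _ _).symm }
  map_id a := NatTrans.ext (funext fun b => regularMap_id _ _)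
  map_comp α α' := NatTrans.ext (funext fun b =>
    (congrArg (regularMap _) (Category.comp_id (𝟙 b)).symm).trans (regularMap_comp _ _ _ _).symm)

end ConjCat

end Conjugation

/-! ### (Co)products indexed by based sets, bimodules, and the induced adjunction -/

section Bimodules

variable {C : Type u} [Category.{v} C] [HasZeroMorphisms C]

section Coproducts

variable [HasColimits C]

/-- `X ⊗ S`: the coproduct of copies of `X`, one for each element of `S` other than the
basepoint. -/
noncomputable abbrev copower (X : C) (S : Pointed.{v}) : C := ∐ fun _ : {s : S // s ≠ S.point} => X

open Classical in
/-- The inclusion of the summand of an element of `S`; it is zero for the basepoint. -/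
noncomputable def copowerι (X : C) (S : Pointed.{v}) (s : S) : X ⟶ copower X S :=
  if hs : s ≠ S.point then Sigma.ι (fun _ : {s : S // s ≠ S.point} => X) ⟨s, hs⟩ else 0

@[simp]
lemma copowerι_point (X : C) (S : Pointed.{v}) : copowerι X S S.point = 0 := by simp [copowerι]

lemma copower_ext {X Y : C} {S : Pointed.{v}} {f g : copower X S ⟶ Y}
    (H : ∀ s, copowerι X S s ≫ f = copowerι X S s ≫ g) : f = g := by
  refine Sigma.hom_ext _ _ fun ⟨s, hs⟩ => ?_
  have := H s
  rwa [copowerι, dif_pos hs] at this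

/-- Maps out of `X ⊗ S`. -/
noncomputable def copowerDesc {X Y : C} {S : Pointed.{v}} (φ : S → (X ⟶ Y)) : copower X S ⟶ Y :=
  Sigma.desc fun s => φ s.1

lemma copowerι_desc {X Y : C} {S : Pointed.{v}} (φ : S → (X ⟶ Y)) (hφ : φ S.point = 0) (s : S) :
    copowerι X S s ≫ copowerDesc φ = φ s := by
  by_cases hs : s = S.point
  · subst hs; rw [copowerι_point, zero_comp, hφ]
  · rw [copowerι, dif_pos hs, copowerDesc, Sigma.ι_desc]

/-- Functoriality of `X ⊗ S` in both variables. -/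
noncomputable def copowerMap {X Y : C} {S T : Pointed.{v}} (f : X ⟶ Y) (φ : S ⟶ T) :
    copower X S ⟶ copower Y T :=
  copowerDesc fun s => f ≫ copowerι Y T (φ.toFun s)

@[simp]
lemma copowerι_map {X Y : C} {S T : Pointed.{v}} (f : X ⟶ Y) (φ : S ⟶ T) (s : S) :
    copowerι X S s ≫ copowerMap f φ = f ≫ copowerι Y T (φ.toFun s) :=
  copowerι_desc _ (by rw [φ.map_point, copowerι_point, comp_zero]) s

@[simp]
lemma copowerι_map_assoc {X Y Z : C} {S T : Pointed.{v}} (f : X ⟶ Y) (φ : S ⟶ T) (s : S)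
    (g : copower Y T ⟶ Z) :
    copowerι X S s ≫ copowerMap f φ ≫ g = f ≫ copowerι Y T (φ.toFun s) ≫ g := by
  rw [← Category.assoc, copowerι_map, Category.assoc]

end Coproducts

section Products

variable [HasLimits C]

/-- `∏_S X`: the product of copies of `X`, one for each element of `S` other than the
basepoint. -/
noncomputable abbrev power (X : C) (S : Pointed.{v}) : C := ∏ᶜ fun _ : {s : S // s ≠ S.point} => X

open Classical in
/-- The projection to the factor of an element of `S`; it is zero for the basepoint. -/
noncomputable def powerπ (X : C) (S : Pointed.{v}) (s : S) : power X S ⟶ X :=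
  if hs : s ≠ S.point then Pi.π (fun _ : {s : S // s ≠ S.point} => X) ⟨s, hs⟩ else 0

@[simp]
lemma powerπ_point (X : C) (S : Pointed.{v}) : powerπ X S S.point = 0 := by simp [powerπ]

lemma power_ext {X Y : C} {S : Pointed.{v}} {f g : Y ⟶ power X S}
    (H : ∀ s, f ≫ powerπ X S s = g ≫ powerπ X S s) : f = g := by
  refine Pi.hom_ext _ _ fun ⟨s, hs⟩ => ?_
  have := H s
  rwa [powerπ, dif_pos hs] at this

/-- Maps into `∏_S X`. -/
noncomputable def powerLift {X Y : C} {S : Pointed.{v}} (φ : S → (Y ⟶ X)) : Y ⟶ power X S :=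
  Pi.lift fun s => φ s.1

lemma powerLift_π {X Y : C} {S : Pointed.{v}} (φ : S → (Y ⟶ X)) (hφ : φ S.point = 0) (s : S) :
    powerLift φ ≫ powerπ X S s = φ s := by
  by_cases hs : s = S.point
  · subst hs; rw [powerπ_point, comp_zero, hφ]
  · rw [powerπ, dif_pos hs, powerLift, Pi.lift_π]

lemma powerLift_π_assoc {X Y Z : C} {S : Pointed.{v}} (φ : S → (Y ⟶ X)) (hφ : φ S.point = 0)
    (s : S) (g : X ⟶ Z) : powerLift φ ≫ powerπ X S s ≫ g = φ s ≫ g := by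
  rw [← Category.assoc, powerLift_π φ hφ]

/-- Functoriality of `∏_S X` in both variables. -/
noncomputable def powerMap {X Y : C} {S T : Pointed.{v}} (f : X ⟶ Y) (φ : S ⟶ T) :
    power X T ⟶ power Y S :=
  powerLift fun s => powerπ X T (φ.toFun s) ≫ f

@[simp]
lemma powerMap_π {X Y : C} {S T : Pointed.{v}} (f : X ⟶ Y) (φ : S ⟶ T) (s : S) :
    powerMap f φ ≫ powerπ Y S s = powerπ X T (φ.toFun s) ≫ f :=
  powerLift_π _ (by rw [φ.map_point, powerπ_point, zero_comp]) s

@[simp]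
lemma powerMap_π_assoc {X Y Z : C} {S T : Pointed.{v}} (f : X ⟶ Y) (φ : S ⟶ T) (s : S)
    (g : Y ⟶ Z) :
    powerMap f φ ≫ powerπ Y S s ≫ g = powerπ X T (φ.toFun s) ≫ f ≫ g := by
  rw [← Category.assoc, powerMap_π, Category.assoc]

end Products

variable {A B : Type v} [SmallCategory A] [SmallCategory B]

section Tensor

variable [HasColimits C]

/-- The free functor `F_d^X : Dᵒᵖ ⥤ C`, `x ↦ X ⊗ D(x, d)₊`. -/
noncomputable abbrev freeFunctor {D : Type v} [SmallCategory D] (d : D) (X : C) : Dᵒᵖ ⥤ C where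
  obj x := copower X (typeToPointed.obj (x.unop ⟶ d))
  map f := copowerMap (𝟙 X) (typeToPointed.map ((yoneda.obj d).map f))
  map_id x := copower_ext fun s => by
    rw [copowerι_map, CategoryTheory.Functor.map_id, CategoryTheory.Functor.map_id]
    simp
  map_comp f g := copower_ext fun s => by
    rw [copowerι_map, copowerι_map_assoc, copowerι_map, CategoryTheory.Functor.map_comp,
      CategoryTheory.Functor.map_comp]
    simp

/-- The diagram `(x, y) ↦ F(x) ⊗ Q(y)`. -/
noncomputable abbrev tensorDiagram (F : Bᵒᵖ ⥤ C) (Q : B ⥤ Pointed.{v}) : Bᵒᵖ ⥤ B ⥤ C where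
  obj x :=
    { obj := fun y => copower (F.obj x) (Q.obj y)
      map := fun β => copowerMap (𝟙 (F.obj x)) (Q.map β)
      map_id := fun y => copower_ext fun s => by simp
      map_comp := fun β β' => copower_ext fun s => by simp }
  map f :=
    { app := fun y => copowerMap (F.map f) (𝟙 (Q.obj y))
      naturality := fun y y' β => copower_ext fun s => by simp }
  map_id x := NatTrans.ext (funext fun y => copower_ext fun s => by simp)
  map_comp f f' := NatTrans.ext (funext fun y => copower_ext fun s => by simp)

/-- The tensor product `F ⊗_B Q`: the coend of `(x, y) ↦ F(x) ⊗ Q(y)`. -/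
noncomputable abbrev tensorObj (F : Bᵒᵖ ⥤ C) (Q : B ⥤ Pointed.{v}) : C :=
  coend (tensorDiagram F Q)

/-- The map `F(b) ⟶ F ⊗_B Q` given by an element of `Q(b)`. -/
noncomputable def tensorι (F : Bᵒᵖ ⥤ C) (Q : B ⥤ Pointed.{v}) (b : B) (s : Q.obj b) :
    F.obj (op b) ⟶ tensorObj F Q :=
  copowerι _ _ s ≫ coend.ι (tensorDiagram F Q) b

@[simp]
lemma tensorι_point (F : Bᵒᵖ ⥤ C) (Q : B ⥤ Pointed.{v}) (b : B) :
    tensorι F Q b (Q.obj b).point = 0 := by simp [tensorι]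

lemma tensor_ext {F : Bᵒᵖ ⥤ C} {Q : B ⥤ Pointed.{v}} {X : C} {f g : tensorObj F Q ⟶ X}
    (H : ∀ b s, tensorι F Q b s ≫ f = tensorι F Q b s ≫ g) : f = g := by
  refine coend.hom_ext fun b => copower_ext fun s => ?_
  simpa [tensorι] using H b s

lemma tensorι_map (F : Bᵒᵖ ⥤ C) (Q : B ⥤ Pointed.{v}) {b b' : B} (β : b ⟶ b') (s : Q.obj b) :
    F.map β.op ≫ tensorι F Q b s = tensorι F Q b' ((Q.map β).toFun s) := by
  simpa [tensorι] using
    copowerι (F.obj (op b')) (Q.obj b) s ≫= coend.condition (tensorDiagram F Q) β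

/-- Maps out of `F ⊗_B Q`. -/
noncomputable def tensorDesc {F : Bᵒᵖ ⥤ C} {Q : B ⥤ Pointed.{v}} {X : C}
    (φ : ∀ b, Q.obj b → (F.obj (op b) ⟶ X)) (h₀ : ∀ b, φ b (Q.obj b).point = 0)
    (hφ : ∀ b b' (β : b ⟶ b') s, F.map β.op ≫ φ b s = φ b' ((Q.map β).toFun s)) :
    tensorObj F Q ⟶ X :=
  coend.desc (fun b => copowerDesc (φ b)) fun b b' β => copower_ext fun s => by
    dsimp only
    rw [copowerι_map_assoc, copowerι_map_assoc, Category.id_comp]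
    simpa [copowerι_desc, h₀] using hφ _ _ β s

lemma tensorι_desc {F : Bᵒᵖ ⥤ C} {Q : B ⥤ Pointed.{v}} {X : C}
    (φ : ∀ b, Q.obj b → (F.obj (op b) ⟶ X)) (h₀ : ∀ b, φ b (Q.obj b).point = 0)
    (hφ : ∀ b b' (β : b ⟶ b') s, F.map β.op ≫ φ b s = φ b' ((Q.map β).toFun s))
    (b : B) (s : Q.obj b) :
    tensorι F Q b s ≫ tensorDesc φ h₀ hφ = φ b s := by
  rw [tensorι, tensorDesc, Category.assoc, coend.ι_desc]
  exact copowerι_desc _ (h₀ b) s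

lemma tensorι_desc_assoc {F : Bᵒᵖ ⥤ C} {Q : B ⥤ Pointed.{v}} {X Y : C}
    (φ : ∀ b, Q.obj b → (F.obj (op b) ⟶ X)) (h₀ : ∀ b, φ b (Q.obj b).point = 0)
    (hφ : ∀ b b' (β : b ⟶ b') s, F.map β.op ≫ φ b s = φ b' ((Q.map β).toFun s))
    (b : B) (s : Q.obj b) (g : X ⟶ Y) :
    tensorι F Q b s ≫ tensorDesc φ h₀ hφ ≫ g = φ b s ≫ g := by
  rw [← Category.assoc, tensorι_desc]

/-- Functoriality of `F ⊗_B Q` in both variables. -/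
noncomputable def tensorMap {F F' : Bᵒᵖ ⥤ C} {Q Q' : B ⥤ Pointed.{v}} (f : F ⟶ F') (q : Q ⟶ Q') :
    tensorObj F Q ⟶ tensorObj F' Q' :=
  tensorDesc (fun b s => f.app (op b) ≫ tensorι F' Q' b ((q.app b).toFun s))
    (fun b => by simp [(q.app b).map_point])
    (fun b b' β s => by
      rw [f.naturality_assoc, tensorι_map]
      congr 2
      exact congr_fun (congrArg Pointed.Hom.toFun (q.naturality β)).symm s)

@[simp]
lemma tensorι_tensorMap {F F' : Bᵒᵖ ⥤ C} {Q Q' : B ⥤ Pointed.{v}} (f : F ⟶ F') (q : Q ⟶ Q')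
    (b : B) (s : Q.obj b) :
    tensorι F Q b s ≫ tensorMap f q = f.app (op b) ≫ tensorι F' Q' b ((q.app b).toFun s) :=
  tensorι_desc _ _ _ _ _

@[simp]
lemma tensorι_tensorMap_assoc {F F' : Bᵒᵖ ⥤ C} {Q Q' : B ⥤ Pointed.{v}} (f : F ⟶ F')
    (q : Q ⟶ Q') (b : B) (s : Q.obj b) {Y : C} (g : tensorObj F' Q' ⟶ Y) :
    tensorι F Q b s ≫ tensorMap f q ≫ g =
      f.app (op b) ≫ tensorι F' Q' b ((q.app b).toFun s) ≫ g := by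
  rw [← Category.assoc, tensorι_tensorMap, Category.assoc]

end Tensor

section Hom

variable [HasLimits C]

/-- The diagram `(x, y) ↦ ∏_{P(y)} G(x)`. -/
noncomputable abbrev homDiagram (P : Aᵒᵖ ⥤ Pointed.{v}) (G : Aᵒᵖ ⥤ C) : Aᵒᵖ ⥤ A ⥤ C where
  obj x :=
    { obj := fun y => power (G.obj x) (P.obj (op y))
      map := fun α => powerMap (𝟙 (G.obj x)) (P.map α.op)
      map_id := fun y => power_ext fun s => by simp
      map_comp := fun α α' => power_ext fun s => by simp }
  map f :=
    { app := fun y => powerMap (G.map f) (𝟙 (P.obj (op y)))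
      naturality := fun y y' α => power_ext fun s => by simp }
  map_id x := NatTrans.ext (funext fun y => power_ext fun s => by simp)
  map_comp f f' := NatTrans.ext (funext fun y => power_ext fun s => by simp)

/-- `Hom^A(P, G)`: the end of `(x, y) ↦ ∏_{P(y)} G(x)`. -/
noncomputable abbrev homObj (P : Aᵒᵖ ⥤ Pointed.{v}) (G : Aᵒᵖ ⥤ C) : C := end_ (homDiagram P G)

/-- The map `Hom^A(P, G) ⟶ G(a)` given by an element of `P(a)`. -/
noncomputable def homπ (P : Aᵒᵖ ⥤ Pointed.{v}) (G : Aᵒᵖ ⥤ C) (a : A) (s : P.obj (op a)) :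
    homObj P G ⟶ G.obj (op a) :=
  end_.π (homDiagram P G) a ≫ powerπ _ _ s

@[simp]
lemma homπ_point (P : Aᵒᵖ ⥤ Pointed.{v}) (G : Aᵒᵖ ⥤ C) (a : A) :
    homπ P G a (P.obj (op a)).point = 0 := by simp [homπ]

lemma hom_ext' {P : Aᵒᵖ ⥤ Pointed.{v}} {G : Aᵒᵖ ⥤ C} {X : C} {f g : X ⟶ homObj P G}
    (H : ∀ a s, f ≫ homπ P G a s = g ≫ homπ P G a s) : f = g := by
  refine end_.hom_ext fun a => power_ext fun s => ?_
  simpa [homπ] using H a s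

lemma homπ_map (P : Aᵒᵖ ⥤ Pointed.{v}) (G : Aᵒᵖ ⥤ C) {a a' : A} (α : a ⟶ a')
    (s : P.obj (op a')) :
    homπ P G a' s ≫ G.map α.op = homπ P G a ((P.map α.op).toFun s) := by
  simpa [homπ] using
    (end_.condition (homDiagram P G) α =≫ powerπ (G.obj (op a)) (P.obj (op a')) s).symm

/-- Maps into `Hom^A(P, G)`. -/
noncomputable def homLift {P : Aᵒᵖ ⥤ Pointed.{v}} {G : Aᵒᵖ ⥤ C} {X : C}
    (φ : ∀ a, P.obj (op a) → (X ⟶ G.obj (op a))) (h₀ : ∀ a, φ a (P.obj (op a)).point = 0)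
    (hφ : ∀ a a' (α : a ⟶ a') s, φ a' s ≫ G.map α.op = φ a ((P.map α.op).toFun s)) :
    X ⟶ homObj P G :=
  end_.lift (fun a => powerLift (φ a)) fun a a' α => power_ext fun s => by
    dsimp only
    rw [Category.assoc, Category.assoc, powerMap_π, powerMap_π, Category.comp_id]
    simpa [powerLift_π, powerLift_π_assoc, h₀] using (hφ _ _ α s).symm

lemma homLift_π {P : Aᵒᵖ ⥤ Pointed.{v}} {G : Aᵒᵖ ⥤ C} {X : C}
    (φ : ∀ a, P.obj (op a) → (X ⟶ G.obj (op a))) (h₀ : ∀ a, φ a (P.obj (op a)).point = 0)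
    (hφ : ∀ a a' (α : a ⟶ a') s, φ a' s ≫ G.map α.op = φ a ((P.map α.op).toFun s))
    (a : A) (s : P.obj (op a)) :
    homLift φ h₀ hφ ≫ homπ P G a s = φ a s := by
  rw [homπ, homLift, end_.lift_π_assoc]
  exact powerLift_π _ (h₀ a) s

lemma homLift_π_assoc {P : Aᵒᵖ ⥤ Pointed.{v}} {G : Aᵒᵖ ⥤ C} {X Y : C}
    (φ : ∀ a, P.obj (op a) → (X ⟶ G.obj (op a))) (h₀ : ∀ a, φ a (P.obj (op a)).point = 0)
    (hφ : ∀ a a' (α : a ⟶ a') s, φ a' s ≫ G.map α.op = φ a ((P.map α.op).toFun s))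
    (a : A) (s : P.obj (op a)) (g : G.obj (op a) ⟶ Y) :
    homLift φ h₀ hφ ≫ homπ P G a s ≫ g = φ a s ≫ g := by
  rw [← Category.assoc, homLift_π]

/-- Functoriality of `Hom^A(P, G)` in both variables. -/
noncomputable def homMap {P P' : Aᵒᵖ ⥤ Pointed.{v}} {G G' : Aᵒᵖ ⥤ C} (p : P' ⟶ P) (g : G ⟶ G') :
    homObj P G ⟶ homObj P' G' :=
  homLift (fun a s => homπ P G a ((p.app (op a)).toFun s) ≫ g.app (op a))
    (fun a => by simp [(p.app (op a)).map_point])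
    (fun a a' α s => by
      rw [Category.assoc, ← g.naturality, ← Category.assoc, homπ_map]
      congr 2
      exact congr_fun (congrArg Pointed.Hom.toFun (p.naturality α.op)).symm s)

@[simp]
lemma homMap_π {P P' : Aᵒᵖ ⥤ Pointed.{v}} {G G' : Aᵒᵖ ⥤ C} (p : P' ⟶ P) (g : G ⟶ G')
    (a : A) (s : P'.obj (op a)) :
    homMap p g ≫ homπ P' G' a s = homπ P G a ((p.app (op a)).toFun s) ≫ g.app (op a) :=
  homLift_π _ _ _ _ _

@[simp]
lemma homMap_π_assoc {P P' : Aᵒᵖ ⥤ Pointed.{v}} {G G' : Aᵒᵖ ⥤ C} (p : P' ⟶ P) (g : G ⟶ G')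
    (a : A) (s : P'.obj (op a)) {Y : C} (k : G'.obj (op a) ⟶ Y) :
    homMap p g ≫ homπ P' G' a s ≫ k =
      homπ P G a ((p.app (op a)).toFun s) ≫ g.app (op a) ≫ k := by
  rw [← Category.assoc, homMap_π, Category.assoc]

end Hom

variable [HasLimits C] [HasColimits C]

/-- The functor `L`, `L F (a) = F ⊗_B P(a, -)`, of a bimodule `P : Aᵒᵖ × B ⥤ Sets_*`. -/
noncomputable abbrev bimoduleL (P : Aᵒᵖ ⥤ B ⥤ Pointed.{v}) : (Bᵒᵖ ⥤ C) ⥤ (Aᵒᵖ ⥤ C) where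
  obj F :=
    { obj := fun a => tensorObj F (P.obj a)
      map := fun α => tensorMap (𝟙 F) (P.map α)
      map_id := fun a => tensor_ext fun b s => by simp
      map_comp := fun α α' => tensor_ext fun b s => by simp }
  map τ :=
    { app := fun a => tensorMap τ (𝟙 (P.obj a))
      naturality := fun a a' α => tensor_ext fun b s => by simp }
  map_id F := NatTrans.ext (funext fun a => tensor_ext fun b s => by simp)
  map_comp τ τ' := NatTrans.ext (funext fun a => tensor_ext fun b s => by simp)

/-- The functor `R`, `R G (b) = Hom^A(P(-, b), G)`, of a bimodule `P : Aᵒᵖ × B ⥤ Sets_*`. -/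
noncomputable abbrev bimoduleR (P : Aᵒᵖ ⥤ B ⥤ Pointed.{v}) : (Aᵒᵖ ⥤ C) ⥤ (Bᵒᵖ ⥤ C) where
  obj G :=
    { obj := fun b => homObj (P.flip.obj b.unop) G
      map := fun β => homMap (P.flip.map β.unop) (𝟙 G)
      map_id := fun b => hom_ext' fun a s => by simp
      map_comp := fun β β' => hom_ext' fun a s => by simp }
  map τ :=
    { app := fun b => homMap (𝟙 (P.flip.obj b.unop)) τ
      naturality := fun b b' β => hom_ext' fun a s => by simp }
  map_id G := NatTrans.ext (funext fun b => hom_ext' fun a s => by simp)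
  map_comp τ τ' := NatTrans.ext (funext fun b => hom_ext' fun a s => by simp)

/-- The transpose `F ⟶ R G` of `τ : L F ⟶ G`: for `s ∈ P(a, b)`, its component `F(b) ⟶ G(a)` is
`F(b) ⟶ F ⊗_B P(a, -) ⟶ G(a)`. -/
noncomputable def bimoduleTranspose (P : Aᵒᵖ ⥤ B ⥤ Pointed.{v}) {F : Bᵒᵖ ⥤ C} {G : Aᵒᵖ ⥤ C}
    (τ : (bimoduleL P).obj F ⟶ G) : F ⟶ (bimoduleR P).obj G where
  app b := homLift (P := P.flip.obj b.unop)
    (fun a s => tensorι F (P.obj (op a)) b.unop s ≫ τ.app (op a))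
    (fun a => by
      exact (congrArg (· ≫ τ.app (op a)) (tensorι_point F (P.obj (op a)) b.unop)).trans zero_comp)
    (fun a a' α s => by
      rw [Category.assoc, ← τ.naturality]
      simp)
  naturality b b' β := hom_ext' fun a s => by
    rw [Category.assoc, homLift_π, Category.assoc, homMap_π, homLift_π_assoc, ← Category.assoc]
    have := tensorι_map F (P.obj (op a)) β.unop s
    rw [Quiver.Hom.op_unop] at this
    rw [this]
    simp

lemma bimoduleTranspose_π (P : Aᵒᵖ ⥤ B ⥤ Pointed.{v}) {F : Bᵒᵖ ⥤ C} {G : Aᵒᵖ ⥤ C}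
    (τ : (bimoduleL P).obj F ⟶ G) (b : Bᵒᵖ) (a : A) (s : (P.flip.obj b.unop).obj (op a)) :
    (bimoduleTranspose P τ).app b ≫ homπ (P.flip.obj b.unop) G a s =
      tensorι F (P.obj (op a)) b.unop s ≫ τ.app (op a) := by
  rw [bimoduleTranspose, homLift_π]

/-- The inverse of `bimoduleTranspose`. -/
noncomputable def bimoduleTransposeInv (P : Aᵒᵖ ⥤ B ⥤ Pointed.{v}) {F : Bᵒᵖ ⥤ C} {G : Aᵒᵖ ⥤ C}
    (σ : F ⟶ (bimoduleR P).obj G) : (bimoduleL P).obj F ⟶ G where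
  app a := tensorDesc (Q := P.obj a)
    (fun b s => σ.app (op b) ≫ homπ (P.flip.obj b) G a.unop s)
    (fun b => by
      exact (congrArg (σ.app (op b) ≫ ·) (homπ_point (P.flip.obj b) G a.unop)).trans comp_zero)
    (fun b b' β s => by
      rw [← Category.assoc, σ.naturality]
      simp)
  naturality a a' α := tensor_ext fun b s => by
    rw [tensorι_desc_assoc, tensorι_tensorMap_assoc, tensorι_desc, Category.assoc]
    have := homπ_map (P.flip.obj b) G α.unop s
    rw [Quiver.Hom.op_unop] at this
    rw [this]
    simp

lemma tensorι_bimoduleTransposeInv (P : Aᵒᵖ ⥤ B ⥤ Pointed.{v}) {F : Bᵒᵖ ⥤ C} {G : Aᵒᵖ ⥤ C}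
    (σ : F ⟶ (bimoduleR P).obj G) (a : Aᵒᵖ) (b : B) (s : (P.obj a).obj b) :
    tensorι F (P.obj a) b s ≫ (bimoduleTransposeInv P σ).app a =
      σ.app (op b) ≫ homπ (P.flip.obj b) G a.unop s := by
  rw [bimoduleTransposeInv, tensorι_desc]

/-- The adjunction `L ⊣ R` of a bimodule. -/
noncomputable def bimoduleAdjunction (P : Aᵒᵖ ⥤ B ⥤ Pointed.{v}) :
    bimoduleL (C := C) P ⊣ bimoduleR P :=
  Adjunction.mkOfHomEquiv
    { homEquiv := fun F G =>
        { toFun := bimoduleTranspose P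
          invFun := bimoduleTransposeInv P
          left_inv := fun τ => NatTrans.ext (funext fun a => tensor_ext fun b s =>
            (tensorι_bimoduleTransposeInv P _ a b s).trans (bimoduleTranspose_π P τ _ _ s))
          right_inv := fun σ => NatTrans.ext (funext fun b => hom_ext' fun a s =>
            (bimoduleTranspose_π P _ b a s).trans (tensorι_bimoduleTransposeInv P σ _ _ s)) }
      homEquiv_naturality_left_symm := fun {F F' G} f g =>
        NatTrans.ext (funext fun a => tensor_ext fun b s =>
          (tensorι_bimoduleTransposeInv P (f ≫ g) a b s).trans (by
            have := tensorι_bimoduleTransposeInv P g a b s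
            change _ = tensorι F (P.obj a) b s ≫ tensorMap f (𝟙 (P.obj a)) ≫
              (bimoduleTransposeInv P g).app a
            rw [tensorι_tensorMap_assoc, NatTrans.comp_app, Category.assoc, ← this]
            rfl))
      homEquiv_naturality_right := fun {F G G'} f g =>
        NatTrans.ext (funext fun b => hom_ext' fun a s =>
          (bimoduleTranspose_π P (f ≫ g) b a s).trans (by
            have := bimoduleTranspose_π P f b a s
            change _ = ((bimoduleTranspose P f).app b ≫ homMap (𝟙 (P.flip.obj b.unop)) g) ≫
              homπ (P.flip.obj b.unop) G' a s
            rw [Category.assoc, homMap_π, NatTrans.comp_app, ← Category.assoc, ← this,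
              Category.assoc]
            rfl)) }

end Bimodules

/-- The regular bimodule of a conjugate pair `(B, A)`, where `B` is equivalent to the category
`I ∘ A ∘ Iᵒᵖ` constructed from a factorization `U = I ∘ A` admitting conjugation. -/
noncomputable def conjugatePairBimodule {U : Type v} [SmallCategory U] {I A : MorphismProperty U}
    [I.IsMultiplicative] [A.IsMultiplicative] (h : AdmitsConjugation I A)
    {B : Type v} [SmallCategory B] (e : B ≌ ConjCat h) :
    (WideSubcategory A)ᵒᵖ ⥤ B ⥤ Pointed.{v} :=
  ConjCat.regularBimodule h ⋙ (Functor.whiskeringLeft B (ConjCat h) Pointed.{v}).obj e.functor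

-- Fix an object `x` and evaluate the unit there. By the finiteness axiom for indexing categories,
-- the maps of `I` into `x` have finitely many isomorphism classes, and since maps of `I` are monic
-- these form a finite poset `Subobj x` under factorization. Write `s : c_s ⟶ x` for a chosen
-- representative of a class.
--
-- Both sides of the unit split over this poset. A map `x ⟶ b` is uniquely a restriction `s*`
-- followed by a regular map, so `F(x)` is the coproduct over `s` of `X ⊗ U(c_s, b)₊`
-- (`freeFunctorIsColimit`). A regular map into `x` is uniquely a map of `A` followed by some `t`,
-- so the presheaf `U(-, x)₊` is free on `Subobj x`, and `R G(x)` is the product over `t` of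
-- `G(c_t)` (`bimoduleRIsLimit`). For `G = L F`, the co-Yoneda lemma identifies `G(c_t)` with `X ⊗
-- U(c_t, b)₊` (`isIso_coyonedaMap`).
--
-- The unit thus becomes a matrix whose `(s, t)` entry sends the summand of `γ` to that of `γ ∘ s* ∘
-- t`, or to zero if this composite is singular. On the diagonal `s* ∘ s = 1`, so the entry is an
-- isomorphism; if the composite is regular then `t` factors through `s`, so the entry vanishes
-- unless `t ≤ s`. The Lower Triangular Axiom, applied inductively along a linear extension of the
-- poset, shows that such a triangular matrix is a weak equivalence
-- (`IsSemiStable.weakEquivalence_of_triangular`).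

universe w

/-! ### Triangular matrices from finite coproducts to finite products. -/

section TriangularMaps

attribute [local simp] prod.lift_fst prod.lift_snd prod.lift_fst_assoc prod.lift_snd_assoc
  coprod.inl_desc coprod.inr_desc coprod.inl_desc_assoc coprod.inr_desc_assoc

variable {C : Type u} [Category.{v} C] [ModelCategory C]

/-- A coproduct of cofibrant objects is cofibrant. -/
lemma isCofibrant_of_isColimit_cofan {J : Type w} {A : J → C} [∀ j, IsCofibrant (A j)]
    {c : Cofan A} (hc : IsColimit c) : IsCofibrant c.pt := by
  -- A coproduct of initial objects is initial, so the map from the initial object to `c.pt` is the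
  -- coproduct of the maps from it to the `A j`, and cofibrations are closed under coproducts.
  let c₀ : Cofan (fun _ : J => (⊥_ C)) := Cofan.mk (⊥_ C) (fun _ => 𝟙 _)
  have hc₀ : IsColimit c₀ :=
    Cofan.IsColimit.mk c₀ (fun s => initial.to s.pt) (fun _ _ => initial.hom_ext _ _)
      (fun _ _ _ => initial.hom_ext _ _)
  have h : cofibrations C (initial.to c.pt) :=
    MorphismProperty.IsStableUnderColimitsOfShape.condition (W := cofibrations C)
      (J := Discrete J) _ _ c₀ c hc₀ hc (Discrete.natTrans fun j => initial.to (A j.as))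
      (fun j => (cofibration_iff (initial.to (A j.as))).1 inferInstance) (initial.to c.pt)
      (fun j => initial.hom_ext _ _)
  exact ⟨h⟩

variable [HasLimits C] [HasColimits C] [HasZeroObject C]

/-- The product of a weak equivalence with an identity is a weak equivalence, because it is a base
change of it along a projection. -/
lemma IsNiceModelCategory.weakEquivalence_prod_map_id (hC : IsNiceModelCategory C) {X Y : C} (A : C)
    (f : X ⟶ Y) (hf : WeakEquivalence f) : WeakEquivalence (prod.map (𝟙 A) f) := by
  have sq : IsPullback (prod.map (𝟙 A) f) prod.snd prod.snd f := by
    refine ⟨⟨by simp⟩, ⟨PullbackCone.IsLimit.mk _ (fun s => prod.lift (s.fst ≫ prod.fst) s.snd)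
      (fun s => ?_) (fun s => by simp) (fun s m h₁ h₂ => ?_)⟩⟩
    · ext
      · simp
      · simpa using s.condition.symm
    · ext
      · simp [← h₁]
      · simpa using h₂
  exact hC.right_proper _ _ _ _ sq (hC.fibration_snd A Y) hf

variable [HasZeroMorphisms C]

/-- Index `0` is split off, which turns `f` into a 2 × 2 block matrix. The block on the remaining
indices is a weak equivalence by induction, and the block from `A 0` to the remaining factors
vanishes. -/
lemma IsSemiStable.weakEquivalence_of_triangular_fin (hC : IsSemiStable C) (n : ℕ)
    (A A' : Fin n → C) [∀ i, IsCofibrant (A i)] (c : Cofan A) (hc : IsColimit c)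
    (p : Fan A') (hp : IsLimit p) (f : c.pt ⟶ p.pt) (hd : ∀ i, IsIso (c.inj i ≫ f ≫ p.proj i))
    (hz : ∀ i j, i < j → c.inj i ≫ f ≫ p.proj j = 0) : WeakEquivalence f := by
  induction n with
  | zero =>
    -- The empty coproduct and the empty product are both zero objects.
    have : IsIso f := ⟨0, Cofan.IsColimit.hom_ext hc _ _ fun i => i.elim0,
      Fan.IsLimit.hom_ext hp _ _ fun i => i.elim0⟩
    infer_instance
  | succ n ih =>
    let d := c.inj 0 ≫ f ≫ p.proj 0
    have : IsIso d := hd 0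
    obtain ⟨S, ⟨hS⟩⟩ : ∃ S : Cofan fun i : Fin n => A i.succ, Nonempty (IsColimit S) :=
      ⟨_, ⟨coproductIsCoproduct _⟩⟩
    obtain ⟨P, ⟨hP⟩⟩ : ∃ P : Fan fun i : Fin n => A' i.succ, Nonempty (IsLimit P) :=
      ⟨_, ⟨productIsProduct _⟩⟩
    let s : S.pt ⟶ c.pt := Cofan.IsColimit.desc hS fun i => c.inj i.succ
    let t : p.pt ⟶ P.pt := Fan.IsLimit.lift hP fun i => p.proj i.succ
    have hs (i : Fin n) : S.inj i ≫ s = c.inj i.succ :=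
      Cofan.IsColimit.fac hS _ i
    have ht (i : Fin n) : t ≫ P.proj i = p.proj i.succ :=
      Fan.IsLimit.fac hP _ i
    have w : WeakEquivalence (s ≫ f ≫ t) := by
      refine ih _ _ S hS P hP (s ≫ f ≫ t) (fun i => ?_) (fun i j hij => ?_)
      · simpa only [Category.assoc, ht, reassoc_of% (hs i)] using hd i.succ
      · simpa only [Category.assoc, ht, reassoc_of% (hs i)] using
          hz i.succ j.succ (Fin.succ_lt_succ_iff.2 hij)
    have : IsCofibrant S.pt := isCofibrant_of_isColimit_cofan hS
    -- The Lower Triangular Axiom needs the same two objects in source and target, whereas `f`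
    -- changes them. The matrix is therefore normalized to have identities on the diagonal. Its
    -- remaining entry is divided by `d`, which is possible because `d` is an isomorphism and not
    -- merely a weak equivalence.
    let g : A 0 ⨿ S.pt ⟶ A 0 ⨯ S.pt :=
      coprod.desc (prod.lift (𝟙 _) 0) (prod.lift ((s ≫ f ≫ p.proj 0) ≫ inv d) (𝟙 _))
    have hg : WeakEquivalence g := by
      refine hC.lower_triangular (A 0) S.pt g ?_ ?_ ?_
      · simp only [g, coprod.inl_desc_assoc, prod.lift_fst]; infer_instance
      · simp only [g, coprod.inr_desc_assoc, prod.lift_snd]; infer_instance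
      · simp [g]
    have hg' : WeakEquivalence (prod.map (𝟙 (A 0)) (s ≫ f ≫ t)) :=
      hC.toIsNiceModelCategory.weakEquivalence_prod_map_id _ _ w
    let e₁ : A 0 ⨿ S.pt ⟶ c.pt := coprod.desc (c.inj 0) s
    let e₁' : c.pt ⟶ A 0 ⨿ S.pt := Cofan.IsColimit.desc hc
      (fun i => Fin.cases coprod.inl (fun i => S.inj i ≫ coprod.inr) i)
    have he₀ : c.inj 0 ≫ e₁' = coprod.inl := Cofan.IsColimit.fac hc _ 0
    have he (i : Fin n) : c.inj i.succ ≫ e₁' = S.inj i ≫ coprod.inr :=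
      Cofan.IsColimit.fac hc _ i.succ
    have : IsIso e₁ := by
      refine ⟨e₁', ?_, ?_⟩
      · refine coprod.hom_ext ?_ (Cofan.IsColimit.hom_ext hS _ _ fun i => ?_)
        · simp [e₁, he₀]
        · simp [e₁, reassoc_of% (hs i), he]
      · refine Cofan.IsColimit.hom_ext hc _ _ fun i => ?_
        induction i using Fin.cases with
        | zero => simp [e₁, reassoc_of% he₀]
        | succ i => simp [e₁, reassoc_of% (he i), hs]
    let e₂ : p.pt ⟶ A' 0 ⨯ P.pt := prod.lift (p.proj 0) t
    let e₂' : A' 0 ⨯ P.pt ⟶ p.pt := Fan.IsLimit.lift hp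
      (fun i => Fin.cases prod.fst (fun i => prod.snd ≫ P.proj i) i)
    have hp₀ : e₂' ≫ p.proj 0 = prod.fst := Fan.IsLimit.fac hp _ 0
    have hp' (i : Fin n) : e₂' ≫ p.proj i.succ = prod.snd ≫ P.proj i :=
      Fan.IsLimit.fac hp _ i.succ
    have : IsIso e₂ := by
      refine ⟨e₂', ?_, ?_⟩
      · refine Fan.IsLimit.hom_ext hp _ _ fun i => ?_
        induction i using Fin.cases with
        | zero => simp [e₂, hp₀]
        | succ i => simp [e₂, hp', ht]
      · refine prod.hom_ext ?_ (Fan.IsLimit.hom_ext hP _ _ fun i => ?_)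
        · simp [e₂, hp₀]
        · simp [e₂, ht, hp']
    -- The block matrix is the unipotent matrix `g` followed by the diagonal matrix with entries `d`
    -- and `s ≫ f ≫ t`. The vanishing hypothesis enters only in the second of the four entries.
    have e : e₁ ≫ f ≫ e₂ = g ≫ prod.map (𝟙 (A 0)) (s ≫ f ≫ t) ≫ prod.map d (𝟙 P.pt) := by
      refine coprod.hom_ext (prod.hom_ext ?_ (Fan.IsLimit.hom_ext hP _ _ fun i => ?_)) (prod.hom_ext ?_ ?_)
      · simp [e₁, e₂, g, d]
      · simpa [e₁, e₂, g, ht] using hz 0 i.succ (Fin.succ_pos i)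
      · simp [e₁, e₂, g]
      · simp [e₁, e₂, g]
    have hef : WeakEquivalence (e₁ ≫ f ≫ e₂) := by rw [e]; infer_instance
    have : WeakEquivalence (f ≫ e₂) := weakEquivalence_of_precomp e₁ (f ≫ e₂)
    exact weakEquivalence_of_postcomp f e₂

/-- In a semi-stable model category, a map from a finite coproduct of cofibrant objects to a finite
product that is triangular for some partial order on the indices, with isomorphisms on the diagonal,
is a weak equivalence. -/
lemma IsSemiStable.weakEquivalence_of_triangular (hC : IsSemiStable C) {ι : Type w} [Finite ι]
    [PartialOrder ι] {A A' : ι → C} [∀ i, IsCofibrant (A i)] {c : Cofan A} (hc : IsColimit c)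
    {p : Fan A'} (hp : IsLimit p) (f : c.pt ⟶ p.pt) (hd : ∀ i, IsIso (c.inj i ≫ f ≫ p.proj i))
    (hz : ∀ i j, ¬ j ≤ i → c.inj i ≫ f ≫ p.proj j = 0) : WeakEquivalence f := by
  let : Fintype ι := Fintype.ofFinite ι
  let : Fintype (LinearExtension ι) := ‹Fintype ι›
  -- The indices are enumerated along a linear extension of the partial order. If `i < j` in the
  -- enumeration, then `e' j ≤ e' i` is impossible, so the entries above the diagonal vanish.
  let e : Fin (Fintype.card (LinearExtension ι)) ≃o LinearExtension ι :=
    Fintype.orderIsoFinOfCardEq (LinearExtension ι) rfl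
  let e' : Fin (Fintype.card (LinearExtension ι)) ≃ ι := e.toEquiv
  have he' {i j} (hij : e' j ≤ e' i) : j ≤ i :=
    e.le_iff_le.1 (toLinearExtension (α := ι).monotone hij)
  exact hC.weakEquivalence_of_triangular_fin _ (fun i => A (e' i)) (fun i => A' (e' i))
    (Cofan.mk c.pt fun i => c.inj (e' i)) (Cofan.isColimitEquivOfEquiv e' c hc)
    (Fan.mk p.pt fun i => p.proj (e' i)) (Fan.isLimitEquivOfEquiv e' p hp)
    f (fun i => hd _) (fun i j hij => hz _ _ fun H => hij.not_ge (he' H))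

end TriangularMaps

/-! ### Wedges of based sets, free presheaves and the co-Yoneda lemma. -/

section FreeDiagrams

variable {C : Type u} [Category.{v} C] [HasZeroMorphisms C]

open Classical in
/-- If the based set `T` is the wedge of the based sets `S i`, then `X ⊗ T` is the coproduct of
the objects `X ⊗ S i`. -/
noncomputable def copowerIsColimit [HasColimits C] (X : C) {ι : Type w} {S : ι → Pointed.{v}}
    {T : Pointed.{v}} (q : ∀ i, S i ⟶ T)
    (hq : ∀ t, t ≠ T.point → ∃ i s, (q i).toFun s = t)
    (hq₀ : ∀ i s, s ≠ (S i).point → (q i).toFun s ≠ T.point)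
    (hinj : ∀ i j s s', s ≠ (S i).point → (q i).toFun s = (q j).toFun s' →
      (⟨i, s⟩ : Σ i, S i) = ⟨j, s'⟩) :
    IsColimit (Cofan.mk (copower X T) fun i => copowerMap (𝟙 X) (q i)) := by
  choose a b hab using hq
  let φ (Z : Cofan fun i => copower X (S i)) (t : T) : X ⟶ Z.pt :=
    if ht : t ≠ T.point then copowerι X _ (b t ht) ≫ Z.inj (a t ht) else 0
  -- The chosen preimage does not matter. Injectivity is an equality of pairs, so the index and the
  -- element are replaced simultaneously, without transport.
  have hφ (Z : Cofan fun i => copower X (S i)) (i : ι) (s : S i) :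
      φ Z ((q i).toFun s) = copowerι X _ s ≫ Z.inj i := by
    by_cases hs : s = (S i).point
    · simp [φ, hs, (q i).map_point]
    · dsimp only [φ]
      rw [dif_pos (hq₀ i s hs)]
      have e := hinj _ _ _ _ hs (hab _ (hq₀ i s hs)).symm
      exact congrArg (fun p : Σ i, S i => copowerι X _ p.2 ≫ Z.inj p.1) e.symm
  have hφ₀ (Z : Cofan fun i => copower X (S i)) : φ Z T.point = 0 := dif_neg (by simp)
  refine Cofan.IsColimit.mk _ (fun Z => copowerDesc (φ Z)) (fun Z i => copower_ext fun s => ?_)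
    (fun Z m hm => copower_ext fun t => ?_)
  · change copowerι X (S i) s ≫ copowerMap (𝟙 X) (q i) ≫ _ = _
    rw [copowerι_map_assoc, Category.id_comp, copowerι_desc _ (hφ₀ Z), hφ]
  · rw [copowerι_desc _ (hφ₀ Z)]
    by_cases ht : t = T.point
    · rw [ht, copowerι_point, zero_comp, hφ₀]
    · rw [← hab t ht, hφ, ← hm]
      change _ = copowerι X (S _) _ ≫ copowerMap (𝟙 X) (q _) ≫ m
      rw [copowerι_map_assoc, Category.id_comp]

variable {A B : Type v} [SmallCategory A] [SmallCategory B]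

open Classical in
/-- If the presheaf of based sets `P` is free on the elements `p i ∈ P(a i)`, then `Hom^A(P, G)` is
the product of the objects `G(a i)`. -/
noncomputable def homObjIsLimit [HasLimits C] (P : Aᵒᵖ ⥤ Pointed.{v}) (G : Aᵒᵖ ⥤ C) {ι : Type w}
    {a : ι → A} (p : ∀ i, P.obj (op (a i)))
    (hp : ∀ x (s : P.obj (op x)), s ≠ (P.obj (op x)).point →
      ∃ i, ∃ f : x ⟶ a i, (P.map f.op).toFun (p i) = s)
    (hp₀ : ∀ i x (f : x ⟶ a i), (P.map f.op).toFun (p i) ≠ (P.obj (op x)).point)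
    (hinj : ∀ i j x (f : x ⟶ a i) (g : x ⟶ a j), (P.map f.op).toFun (p i) = (P.map g.op).toFun (p j) →
      (⟨i, f⟩ : Σ i, x ⟶ a i) = ⟨j, g⟩) :
    IsLimit (Fan.mk (homObj P G) fun i => homπ P G (a i) (p i)) := by
  choose c d hcd using hp
  -- As in the Yoneda lemma, naturality forces this value: an element off the basepoint is the
  -- restriction of a generator `p i` along a unique map, and the basepoint must go to zero.
  let φ (Z : Fan fun i => G.obj (op (a i))) (x : A) (s : P.obj (op x)) : Z.pt ⟶ G.obj (op x) :=
    if hs : s ≠ (P.obj (op x)).point then Z.proj (c x s hs) ≫ G.map (d x s hs).op else 0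
  have hφ (Z : Fan fun i => G.obj (op (a i))) (x : A) (i : ι) (f : x ⟶ a i) :
      φ Z x ((P.map f.op).toFun (p i)) = Z.proj i ≫ G.map f.op := by
    dsimp only [φ]
    rw [dif_pos (hp₀ i x f)]
    exact congrArg (fun p : Σ i, x ⟶ a i => Z.proj p.1 ≫ G.map p.2.op)
      (hinj _ _ _ _ _ (hcd _ _ (hp₀ i x f)))
  have hφ₀ (Z : Fan fun i => G.obj (op (a i))) (x : A) : φ Z x (P.obj (op x)).point = 0 :=
    dif_neg (by simp)
  have hφ' (Z : Fan fun i => G.obj (op (a i))) (x y : A) (f : x ⟶ y) (s : P.obj (op y)) :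
      φ Z y s ≫ G.map f.op = φ Z x ((P.map f.op).toFun s) := by
    by_cases hs : s = (P.obj (op y)).point
    · rw [hs, (P.map f.op).map_point, hφ₀, hφ₀, zero_comp]
    · obtain ⟨i, g, rfl⟩ : ∃ i, ∃ g : y ⟶ a i, (P.map g.op).toFun (p i) = s := ⟨_, _, hcd _ _ hs⟩
      have : (P.map f.op).toFun ((P.map g.op).toFun (p i)) = (P.map (f ≫ g).op).toFun (p i) := by
        simp
      rw [this, hφ, hφ, Category.assoc, op_comp, Functor.map_comp]
  refine Fan.IsLimit.mk _ (fun Z => homLift (φ Z) (hφ₀ Z) (hφ' Z)) (fun Z i => ?_)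
    (fun Z m hm => hom_ext' fun x s => ?_)
  · change homLift (φ Z) (hφ₀ Z) (hφ' Z) ≫ homπ P G (a i) (p i) = _
    rw [homLift_π]
    simpa using hφ Z (a i) i (𝟙 _)
  · rw [homLift_π]
    by_cases hs : s = (P.obj (op x)).point
    · rw [hs, homπ_point, comp_zero, hφ₀]
    · obtain ⟨i, g, rfl⟩ : ∃ i, ∃ g : x ⟶ a i, (P.map g.op).toFun (p i) = s := ⟨_, _, hcd _ _ hs⟩
      -- The projection at a restricted generator is the projection at the generator followed by a
      -- map of `G`, so a cone map is determined by its values on generators.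
      rw [hφ, ← homπ_map, ← hm, Category.assoc]
      rfl

variable [HasColimits C]

/-- The map `X ⊗ Q(b) ⟶ F_b^X ⊗_B Q` of the co-Yoneda lemma. -/
noncomputable def coyonedaMap (b : B) (X : C) (Q : B ⥤ Pointed.{v}) :
    copower X (Q.obj b) ⟶ tensorObj (freeFunctor b X) Q :=
  copowerDesc fun s => copowerι X (typeToPointed.obj (b ⟶ b)) (some (𝟙 b) : Option (b ⟶ b)) ≫
    tensorι (freeFunctor b X) Q b s

lemma copowerι_coyonedaMap (b : B) (X : C) (Q : B ⥤ Pointed.{v}) (s : Q.obj b) :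
    copowerι X (Q.obj b) s ≫ coyonedaMap b X Q =
      copowerι X (typeToPointed.obj (b ⟶ b)) (some (𝟙 b) : Option (b ⟶ b)) ≫
        tensorι (freeFunctor b X) Q b s :=
  copowerι_desc _ (by rw [tensorι_point, comp_zero]) s

/-- The summand of `β` in the free functor is the restriction along `β` of the summand of `𝟙 b`; the
coend relation moves this restriction over to `Q`. -/
lemma copowerι_tensorι (b : B) (X : C) (Q : B ⥤ Pointed.{v}) (x : B) (β : x ⟶ b) (s : Q.obj x) :
    copowerι X (typeToPointed.obj (x ⟶ b)) (some β : Option (x ⟶ b)) ≫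
        tensorι (freeFunctor b X) Q x s =
      copowerι X (Q.obj b) ((Q.map β).toFun s) ≫ coyonedaMap b X Q := by
  rw [copowerι_coyonedaMap, ← tensorι_map, ← Category.assoc]
  congr 1
  refine Eq.symm ((copowerι_map (𝟙 X) (typeToPointed.map ((yoneda.obj b).map β.op)) _).trans ?_)
  rw [Category.id_comp]
  congr 1
  exact congrArg some (Category.comp_id β)

-- The inverse sends the summand of `β : x ⟶ b`, placed at `s` in `Q(x)`, to the summand of
-- `Q(β)(s)`. For the regular bimodule this computes `L F(a)` as `X ⊗ U(a, b)₊`.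
open Classical in
instance isIso_coyonedaMap (b : B) (X : C) (Q : B ⥤ Pointed.{v}) : IsIso (coyonedaMap b X Q) := by
  let φ (x : B) (s : Q.obj x) : (freeFunctor b X).obj (op x) ⟶ copower X (Q.obj b) :=
    copowerDesc fun β : Option (x ⟶ b) => β.elim 0 fun β => copowerι X (Q.obj b) ((Q.map β).toFun s)
  have hφ (x : B) (s : Q.obj x) (β : x ⟶ b) :
      copowerι X (typeToPointed.obj (x ⟶ b)) (some β : Option (x ⟶ b)) ≫ φ x s =
        copowerι X (Q.obj b) ((Q.map β).toFun s) := copowerι_desc _ rfl _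
  -- The only other element of the based set is the basepoint `none`, whose summand map is zero.
  have hext {x : B} {Z : C} {f g : (freeFunctor b X).obj (op x) ⟶ Z}
      (H : ∀ β : x ⟶ b, copowerι X (typeToPointed.obj (x ⟶ b)) (some β : Option (x ⟶ b)) ≫ f =
        copowerι X (typeToPointed.obj (x ⟶ b)) (some β : Option (x ⟶ b)) ≫ g) : f = g := by
    refine copower_ext fun β => ?_
    obtain _ | β := (β : Option (x ⟶ b))
    · exact (((copowerι_point X (typeToPointed.obj (x ⟶ b))) =≫ f).trans zero_comp).trans
        (((copowerι_point X (typeToPointed.obj (x ⟶ b))) =≫ g).trans zero_comp).symm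
    · exact H β
  let ψ : tensorObj (freeFunctor b X) Q ⟶ copower X (Q.obj b) :=
    tensorDesc φ (fun x => hext fun β => by rw [hφ, (Q.map β).map_point, copowerι_point, comp_zero])
      (fun x y f s => hext fun β => by
        rw [hφ]
        refine ((copowerι_map_assoc (𝟙 X) (typeToPointed.map ((yoneda.obj b).map f.op)) _ _).trans
          ?_)
        rw [Category.id_comp]
        refine (hφ x s (f ≫ β)).trans ?_
        simp)
  have hψ (x : B) (s : Q.obj x) : tensorι (freeFunctor b X) Q x s ≫ ψ = φ x s := tensorι_desc _ _ _ _ _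
  refine ⟨ψ, copower_ext fun s => ?_, tensor_ext fun x s => hext fun β => ?_⟩
  · rw [← Category.assoc, copowerι_coyonedaMap, Category.assoc, hψ, hφ]
    simp
  · rw [← Category.assoc (tensorι _ _ _ _), hψ, ← Category.assoc, hφ, Category.comp_id,
      copowerι_tensorι]

end FreeDiagrams

/-! ### Restrictions, and composites of restrictions with inclusions. -/

namespace ConjCat

variable {U : Type v} [SmallCategory U] {I A : MorphismProperty U}
  [I.IsMultiplicative] [A.IsMultiplicative] {h : AdmitsConjugation I A}

/-- The map `i*` of `I ∘ A ∘ Iᵒᵖ` given by a map `i` of `I`. -/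
def restrict {c : U} {x : ConjCat h} (i : c ⟶ x.obj) (hi : I i) : x ⟶ ⟨c⟩ :=
  homMk { a₁ := c, b₁ := c, i := i, α := 𝟙 c, j := 𝟙 c, hi := hi, hα := A.id_mem c, hj := I.id_mem c }

/-- The map of `I ∘ A ∘ Iᵒᵖ` given by a map `j ∘ α` of `U`. -/
def ofU {a c : U} {x : ConjCat h} (α : a ⟶ c) (j : c ⟶ x.obj) (hα : A α) (hj : I j) :
    (⟨a⟩ : ConjCat h) ⟶ x :=
  homMk (ThreeFold.regular α j hα hj)

/-- The inclusion of `I` as a subcategory of `I ∘ A ∘ Iᵒᵖ`. -/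
abbrev inclI {c : U} {x : ConjCat h} (i : c ⟶ x.obj) (hi : I i) : (⟨c⟩ : ConjCat h) ⟶ x :=
  ofU (𝟙 c) i (A.id_mem c) hi

lemma isRegular_ofU {a c : U} {x : ConjCat h} (α : a ⟶ c) (j : c ⟶ x.obj) (hα : A α) (hj : I j) :
    IsRegular (ofU α j hα hj) := ⟨c, α, j, hα, hj, rfl⟩

/-- Maps of `I` are monic in `U`, so the pullback of `i` along itself is trivial. Hence `i` is a
section of `i*`; this gives the diagonal entries of the unit and is the cancellation device for
unique factorization. -/
lemma inclI_restrict {c : U} {x : ConjCat h} (i : c ⟶ x.obj) (hi : I i) :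
    inclI i hi ≫ restrict i hi = 𝟙 (⟨c⟩ : ConjCat h) := by
  refine homMk_comp_of (𝟙 _) (𝟙 _) ?_ (I.id_mem _) (by simp) (by simp [ThreeFold.u])
  refine ⟨⟨by simp [ThreeFold.u]⟩, ⟨PullbackCone.IsLimit.mk _ (fun s => s.fst) (fun s => by simp)
    (fun s => ?_) (fun s m h₁ _ => by simpa using h₁)⟩⟩
  exact h.mono hi (by simpa [ThreeFold.u] using s.condition)

lemma inclI_restrict_assoc {c : U} {x y : ConjCat h} (i : c ⟶ x.obj) (hi : I i)
    (γ : (⟨c⟩ : ConjCat h) ⟶ y) : inclI i hi ≫ restrict i hi ≫ γ = γ := by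
  rw [← Category.assoc, inclI_restrict, Category.id_comp]

/-- If the composite `i'* ∘ i` is regular, then `i` factors through `i'`. -/
lemma exists_fac_of_isRegular {c c' : U} {x : ConjCat h} (i : c ⟶ x.obj) (hi : I i)
    (i' : c' ⟶ x.obj) (hi' : I i') (H : IsRegular (inclI i hi ≫ restrict i' hi')) :
    ∃ θ : c ⟶ c', I θ ∧ θ ≫ i' = i := by
  let f : ThreeFold I A c x.obj := ThreeFold.regular (𝟙 c) i (A.id_mem c) hi
  let g : ThreeFold I A x.obj c' :=
    { a₁ := c', b₁ := c', i := i', α := 𝟙 c', j := 𝟙 c', hi := hi', hα := A.id_mem c',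
      hj := I.id_mem c' }
  obtain ⟨s⟩ := h.exists_composition f g
  have H : IsRegular (homMk s.comp : (⟨c⟩ : ConjCat h) ⟶ ⟨c'⟩) := by
    rw [← homMk_comp s (b := x)]
    exact H
  rw [isRegular_homMk_iff] at H
  -- Here `r` is inverse to the backward leg of the composite, which is the projection to `c` from
  -- the pullback of `i` and `i'`. Following `r` by the projection to `c'` gives the factorization,
  -- which lies in `I` by left cancellation.
  obtain ⟨-, r, -, -, e⟩ := H
  have e : r ≫ s.k'' ≫ 𝟙 c = 𝟙 c := e
  have w : (s.α' ≫ s.j') ≫ i' = s.k'' ≫ 𝟙 c ≫ i := (h.composition_isPullback s).w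
  have hθ : (r ≫ s.α' ≫ s.j') ≫ i' = i := by
    rw [Category.assoc, w]
    simpa using e =≫ i
  exact ⟨r ≫ s.α' ≫ s.j', h.of_comp hi' (by rwa [hθ]), hθ⟩

/-- Every map of `I ∘ A ∘ Iᵒᵖ` is a regular map after some `i*`. -/
lemma restrict_comp_ofU {x y : ConjCat h} (f : ThreeFold I A x.obj y.obj) :
    restrict f.i f.hi ≫ ofU (x := y) f.α f.j f.hα f.hj = homMk f :=
  homMk_comp_of (b := ⟨f.a₁⟩) (𝟙 _) (𝟙 _) (IsPullback.of_vert_isIso ⟨by simp [ThreeFold.u]⟩)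
    (I.id_mem _) (by simp) (by simp [ThreeFold.u])

/-- This permits replacing a map of `I` by an isomorphic representative: the inverse of `φ` is
absorbed into the `A`-part, because isomorphisms of `I` are isomorphisms of `A`. -/
lemma restrict_of_isIsoIn {c c' : U} {x y : ConjCat h} (φ : c ⟶ c') (hφ : IsIsoIn I φ)
    (i : c' ⟶ x.obj) (hi : I i) {d : U} (α : c ⟶ d) (j : d ⟶ y.obj) (hα : A α) (hj : I j) :
    ∃ γ : (⟨c'⟩ : ConjCat h) ⟶ y, IsRegular γ ∧
      restrict (φ ≫ i) (I.comp_mem _ _ hφ.1 hi) ≫ ofU α j hα hj = restrict i hi ≫ γ := by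
  obtain ⟨hφ, ψ, hψ, h₁, h₂⟩ := hφ
  refine ⟨ofU (ψ ≫ α) j (A.comp_mem _ _ (h.iso_le ψ ⟨hψ, φ, hφ, h₂, h₁⟩).1 hα) hj,
    isRegular_ofU _ _ _ _, ?_⟩
  let f : ThreeFold I A x.obj y.obj := ⟨c, d, φ ≫ i, α, j, I.comp_mem _ _ hφ hi, hα, hj⟩
  let g : ThreeFold I A x.obj y.obj :=
    ⟨c', d, i, ψ ≫ α, j, hi, A.comp_mem _ _ (h.iso_le ψ ⟨hψ, φ, hφ, h₂, h₁⟩).1 hα, hj⟩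
  refine (restrict_comp_ofU f).trans (Eq.trans ?_ (restrict_comp_ofU g).symm)
  rw [homMk_eq_iff]
  exact h.rel_of φ ⟨hφ, ψ, hψ, h₁, h₂⟩ rfl (by simp [f, g, ThreeFold.u, reassoc_of% h₁])

lemma inclA_comp_inclI {a : WideSubcategory A} {c : WideSubcategory A} {x : ConjCat h} (α : a ⟶ c)
    (i : c.obj ⟶ x.obj) (hi : I i) :
    (inclA h).map α ≫ inclI i hi = ofU α.hom i α.property hi := by
  refine homMk_comp_of (b := ⟨c.obj⟩) α.hom (𝟙 _) ?_ (I.id_mem _) (Category.comp_id (𝟙 a.obj)).symm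
    (by simp [ThreeFold.u])
  exact IsPullback.of_vert_isIso ⟨by simp [ThreeFold.u]⟩

/-! ### The finite poset of subobjects and the two unique factorizations. -/

/-- The isomorphism classes of maps of `I` with target `x`. -/
def Subobj (x : ConjCat h) : Type v := Skeleton (Over (⟨x.obj⟩ : WideSubcategory I))

namespace Subobj

variable {x : ConjCat h}

/-- The chosen representative of an isomorphism class. -/
noncomputable def rep (s : Subobj x) : Over (⟨x.obj⟩ : WideSubcategory I) :=
  (fromSkeleton (Over (⟨x.obj⟩ : WideSubcategory I))).obj s

/-- The source of the chosen representative. -/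
noncomputable def dom (s : Subobj x) : U := s.rep.left.obj

/-- The chosen representative, as a map of `U`. -/
noncomputable def arrow (s : Subobj x) : s.dom ⟶ x.obj := s.rep.hom.hom

lemma arrow_mem (s : Subobj x) : I s.arrow := s.rep.hom.property

instance : Finite (Subobj x) := h.indexing.finite _

lemma exists_eq {c : U} (i : c ⟶ x.obj) (hi : I i) :
    ∃ (s : Subobj x) (φ : c ⟶ s.dom), IsIsoIn I φ ∧ φ ≫ s.arrow = i := by
  let X : Over (⟨x.obj⟩ : WideSubcategory I) := Over.mk (Y := ⟨c⟩) (inSub i hi)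
  let e := fromSkeletonToSkeletonIso X
  refine ⟨toSkeleton X, e.inv.left.hom, ⟨e.inv.left.property, e.hom.left.hom, e.hom.left.property,
    ?_, ?_⟩, ?_⟩
  · exact congr($(e.inv_hom_id).left.hom)
  · exact congr($(e.hom_inv_id).left.hom)
  · exact congr($(Over.w e.inv).hom)

/-- The two factorizations are mutually inverse because the arrows are monic, so the representatives
are isomorphic over `x`, and isomorphic objects of a skeleton are equal. -/
lemma eq_of_fac {s t : Subobj x} {θ : s.dom ⟶ t.dom} (hθ : I θ) (e : θ ≫ t.arrow = s.arrow)
    {θ' : t.dom ⟶ s.dom} (hθ' : I θ') (e' : θ' ≫ s.arrow = t.arrow) : s = t := by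
  refine skeleton_skeletal (Over (⟨x.obj⟩ : WideSubcategory I)) ?_
  refine ⟨(fromSkeleton _).preimageIso (Over.isoMk (f := s.rep) (g := t.rep)
    ⟨inSub θ hθ, inSub θ' hθ', WideSubcategory.hom_ext _ ?_, WideSubcategory.hom_ext _ ?_⟩
    (WideSubcategory.hom_ext _ e))⟩
  · exact h.mono s.arrow_mem ((Category.assoc θ θ' s.arrow).trans ((congrArg (θ ≫ ·) e').trans
      (e.trans (Category.id_comp _).symm)))
  · exact h.mono t.arrow_mem ((Category.assoc θ' θ t.arrow).trans ((congrArg (θ' ≫ ·) e).trans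
      (e'.trans (Category.id_comp _).symm)))

/-- This is the order for which the matrix of the unit is triangular. -/
instance : PartialOrder (Subobj x) where
  le s t := ∃ θ : s.dom ⟶ t.dom, I θ ∧ θ ≫ t.arrow = s.arrow
  le_refl s := ⟨𝟙 _, I.id_mem _, by simp⟩
  le_trans s t r := by
    rintro ⟨θ, hθ, e⟩ ⟨θ', hθ', e'⟩
    exact ⟨θ ≫ θ', I.comp_mem _ _ hθ hθ', by rw [Category.assoc, e', e]⟩
  le_antisymm s t := by
    rintro ⟨θ, hθ, e⟩ ⟨θ', hθ', e'⟩
    exact eq_of_fac hθ e hθ' e'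

lemma le_of_isRegular {s t : Subobj x}
    (H : IsRegular (inclI s.arrow s.arrow_mem ≫ restrict t.arrow t.arrow_mem)) : s ≤ t :=
  exists_fac_of_isRegular _ _ _ _ H

/-- Every map with source `x` is uniquely a regular map after the restriction to some `s ∈ Subobj x`:
existence. -/
lemma exists_restrict_comp {y : ConjCat h} (β : x ⟶ y) :
    ∃ (s : Subobj x) (γ : (⟨s.dom⟩ : ConjCat h) ⟶ y), IsRegular γ ∧
      restrict s.arrow s.arrow_mem ≫ γ = β := by
  obtain ⟨⟨c, d, i, α, j, hi, hα, hj⟩, rfl⟩ := homMk_surjective β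
  obtain ⟨s, φ, hφ, rfl⟩ := exists_eq i hi
  obtain ⟨γ, hγ, e⟩ := restrict_of_isIsoIn φ hφ s.arrow s.arrow_mem (y := y) α j hα hj
  exact ⟨s, γ, hγ, e.symm.trans (restrict_comp_ofU ⟨_, _, _, _, _, _, _, _⟩)⟩

/-- Every map with source `x` is uniquely a regular map after the restriction to some `s ∈ Subobj x`:
uniqueness. -/
lemma restrict_comp_inj {y : ConjCat h} {s t : Subobj x} {γ : (⟨s.dom⟩ : ConjCat h) ⟶ y}
    {δ : (⟨t.dom⟩ : ConjCat h) ⟶ y} (hγ : IsRegular γ) (hδ : IsRegular δ)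
    (e : restrict s.arrow s.arrow_mem ≫ γ = restrict t.arrow t.arrow_mem ≫ δ) :
    (⟨s, γ⟩ : Σ s : Subobj x, ((⟨s.dom⟩ : ConjCat h) ⟶ y)) = ⟨t, δ⟩ := by
  -- Precomposing the equation with `s` gives `δ ∘ t* ∘ s = γ`, which is regular. A first factor of
  -- a regular map is regular, so `t* ∘ s` is regular and `s` factors through `t`. The other
  -- inequality is symmetric.
  have h₁ : s ≤ t := le_of_isRegular (isRegular_of_comp _ δ (by
    rwa [Category.assoc, ← e, inclI_restrict_assoc]))
  have h₂ : t ≤ s := le_of_isRegular (isRegular_of_comp _ γ (by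
    rwa [Category.assoc, e, inclI_restrict_assoc]))
  obtain rfl := le_antisymm h₁ h₂
  rw [← inclI_restrict_assoc s.arrow s.arrow_mem γ, e, inclI_restrict_assoc]

/-- Every regular map with target `x` factors uniquely as a map of `A` followed by a map in
`Subobj x`: existence. -/
lemma exists_comp_inclI {a : WideSubcategory A} {γ : (inclA h).obj a ⟶ x} (hγ : IsRegular γ) :
    ∃ (s : Subobj x) (α : a ⟶ ⟨s.dom⟩), (inclA h).map α ≫ inclI s.arrow s.arrow_mem = γ := by
  obtain ⟨c, α, j, hα, hj, rfl⟩ := hγ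
  obtain ⟨s, φ, hφ, rfl⟩ := exists_eq j hj
  -- The isomorphism to the chosen representative lies in `A` as well, so it can be moved from the
  -- `I`-part to the `A`-part.
  refine ⟨s, ⟨α ≫ φ, A.comp_mem _ _ hα (h.iso_le φ hφ).1⟩, ?_⟩
  rw [inclA_comp_inclI]
  refine (homMk_eq_iff _ _).2 (h.rel_of (𝟙 a.obj) (.id _) (Category.comp_id (𝟙 a.obj))
    ((Category.id_comp _).trans (Category.assoc α φ s.arrow).symm))

/-- Every regular map with target `x` factors uniquely as a map of `A` followed by a map in
`Subobj x`: uniqueness. -/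
lemma comp_inclI_inj {a : WideSubcategory A} {s t : Subobj x} {α : a ⟶ ⟨s.dom⟩} {β : a ⟶ ⟨t.dom⟩}
    (e : (inclA h).map α ≫ inclI s.arrow s.arrow_mem =
      (inclA h).map β ≫ inclI t.arrow t.arrow_mem) :
    (⟨s, α⟩ : Σ s : Subobj x, (a ⟶ (⟨s.dom⟩ : WideSubcategory A))) = ⟨t, β⟩ := by
  rw [inclA_comp_inclI, inclA_comp_inclI] at e
  obtain ⟨φ, ψ, hφ, ⟨hψ, ψ', hψ', h₁, h₂⟩, e₁, e₂, e₃⟩ := (homMk_eq_iff _ _).1 e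
  dsimp only [ThreeFold.regular] at φ ψ hφ hψ ψ' hψ' h₁ h₂ e₁ e₂ e₃
  rw [Category.comp_id] at e₁
  -- Equivalent diagrams with identity backward legs are related by the identity on `a` and an
  -- isomorphism `ψ` over `x`. The latter forces `s = t`, and then `ψ` is the identity because
  -- `s.arrow` is monic.
  have : s = t := eq_of_fac hψ e₃ hψ' (by rw [← e₃, reassoc_of% h₂])
  subst this
  have : ψ = 𝟙 _ := h.mono s.arrow_mem (by rw [e₃, Category.id_comp])
  rw [this, e₁, Category.id_comp, Category.comp_id] at e₂
  rw [WideSubcategory.hom_ext _ e₂]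

end Subobj

end ConjCat

/-! ### The matrix of the unit at a free functor. -/

namespace ConjCat

variable {U : Type v} [SmallCategory U] {I A : MorphismProperty U}
  [I.IsMultiplicative] [A.IsMultiplicative] {h : AdmitsConjugation I A}
  {B : Type v} [SmallCategory B] (e : B ≌ ConjCat h)

lemma toRegularSet_ne {a b : ConjCat h} {γ : a ⟶ b} (hγ : IsRegular γ) :
    toRegularSet γ ≠ (RegularSet a b).point := by
  rw [toRegularSet_of_regular ⟨γ, hγ⟩]
  exact Option.some_ne_none _

lemma exists_eq_toRegularSet {a b : ConjCat h} {s : RegularSet a b}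
    (hs : s ≠ (RegularSet a b).point) : ∃ γ : a ⟶ b, IsRegular γ ∧ toRegularSet γ = s := by
  obtain _ | γ := s
  · exact absurd rfl hs
  · exact ⟨γ.1, γ.2, toRegularSet_of_regular γ⟩

/-- One regularity hypothesis suffices: a singular `δ` would go to the basepoint, which `γ` does
not. -/
lemma toRegularSet_inj {a b : ConjCat h} {γ δ : a ⟶ b} (hγ : IsRegular γ)
    (e : toRegularSet γ = toRegularSet δ) : γ = δ := by
  have hδ : IsRegular δ := by
    by_contra hδ
    exact toRegularSet_ne hγ (e.trans (toRegularSet_of_not hδ))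
  rw [toRegularSet_of_regular ⟨γ, hγ⟩, toRegularSet_of_regular ⟨δ, hδ⟩] at e
  exact congrArg Subtype.val (Option.some_injective _ e)

/-- For `s : c ⟶ x` in `I`, the injection `U(c, b)₊ ⟶ B(x, b)₊` given by composition with `s*`. -/
noncomputable def restrictMap (x b : B) (s : Subobj (e.functor.obj x)) :
    RegularSet (⟨s.dom⟩ : ConjCat h) (e.functor.obj b) ⟶ typeToPointed.obj (x ⟶ b) where
  toFun γ := Option.map
    (fun γ => e.functor.preimage (restrict s.arrow s.arrow_mem ≫ γ.1)) γ
  map_point := rfl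

lemma restrictMap_toRegularSet (x b : B) (s : Subobj (e.functor.obj x))
    {γ : (⟨s.dom⟩ : ConjCat h) ⟶ e.functor.obj b} (hγ : IsRegular γ) :
    (restrictMap e x b s).toFun (toRegularSet γ) =
      (some (e.functor.preimage (restrict s.arrow s.arrow_mem ≫ γ)) : Option (x ⟶ b)) := by
  rw [toRegularSet_of_regular ⟨γ, hγ⟩]
  rfl

section

variable {C : Type u} [Category.{v} C] [HasZeroMorphisms C]

/-- `F_b^X(x)` is the coproduct of the objects `X ⊗ U(c, b)₊` over the maps `c ⟶ x` in `I`. -/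
noncomputable def freeFunctorIsColimit [HasColimits C] (b : B) (X : C) (x : B) :
    IsColimit (Cofan.mk ((freeFunctor b X).obj (op x))
      fun s : Subobj (e.functor.obj x) => copowerMap (𝟙 X) (restrictMap e x b s)) := by
  refine copowerIsColimit X (restrictMap e x b) (fun t ht => ?_) (fun s γ hγ => ?_)
    (fun s t γ δ hγ H => ?_)
  · obtain _ | β := (t : Option (x ⟶ b))
    · exact absurd rfl ht
    · obtain ⟨s, γ, hγ, H⟩ := Subobj.exists_restrict_comp (e.functor.map β)
      refine ⟨s, toRegularSet γ, (restrictMap_toRegularSet e x b s hγ).trans ?_⟩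
      rw [H, e.functor.preimage_map]
  · obtain ⟨γ, hγ', rfl⟩ := exists_eq_toRegularSet hγ
    rw [restrictMap_toRegularSet e x b s hγ']
    exact Option.some_ne_none _
  · obtain ⟨γ, hγ', rfl⟩ := exists_eq_toRegularSet hγ
    rw [restrictMap_toRegularSet e x b s hγ'] at H
    -- The common image is not the basepoint, so `δ` is not the basepoint either and comes from a
    -- regular map.
    have hδ : δ ≠ (RegularSet (⟨t.dom⟩ : ConjCat h) (e.functor.obj b)).point := by
      rintro rfl
      rw [(restrictMap e x b t).map_point] at H
      exact Option.some_ne_none _ H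
    obtain ⟨δ, hδ', rfl⟩ := exists_eq_toRegularSet hδ
    rw [restrictMap_toRegularSet e x b t hδ'] at H
    have H := congrArg e.functor.map (Option.some_injective _ H)
    rw [e.functor.map_preimage, e.functor.map_preimage] at H
    exact congrArg (fun p : Σ s : Subobj (e.functor.obj x),
      ((⟨s.dom⟩ : ConjCat h) ⟶ e.functor.obj b) =>
        (⟨p.1, toRegularSet p.2⟩ : Σ s : Subobj (e.functor.obj x),
          RegularSet (⟨s.dom⟩ : ConjCat h) (e.functor.obj b))) (Subobj.restrict_comp_inj hγ' hδ' H)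

/-- A map `s : c ⟶ x` of `I`, as an element of `U(c, x)₊`. -/
noncomputable def inclElement (x : B) (s : Subobj (e.functor.obj x)) :
    ((conjugatePairBimodule h e).flip.obj x).obj (op ⟨s.dom⟩) :=
  toRegularSet (inclI s.arrow s.arrow_mem)

lemma map_inclElement (x : B) (s : Subobj (e.functor.obj x)) {a : WideSubcategory A}
    (α : a ⟶ ⟨s.dom⟩) :
    (((conjugatePairBimodule h e).flip.obj x).map α.op).toFun (inclElement e x s) =
      toRegularSet ((inclA h).map α ≫ inclI s.arrow s.arrow_mem) := by
  refine (regularMap_toRegularSet α (𝟙 (e.functor.obj x)) (inclI s.arrow s.arrow_mem)).trans ?_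
  exact congrArg (fun β => toRegularSet ((inclA h).map α ≫ β)) (Category.comp_id _)

lemma isRegular_inclA_comp_inclI {x : ConjCat h} (s : Subobj x) {a : WideSubcategory A}
    (α : a ⟶ ⟨s.dom⟩) : IsRegular ((inclA h).map α ≫ inclI s.arrow s.arrow_mem) := by
  rw [inclA_comp_inclI]
  exact isRegular_ofU _ _ _ _

/-- `R G(x)` is the product of the objects `G(c)` over the maps `c ⟶ x` in `I`. -/
noncomputable def bimoduleRIsLimit [HasLimits C] (G : (WideSubcategory A)ᵒᵖ ⥤ C) (x : B) :
    IsLimit (Fan.mk (homObj ((conjugatePairBimodule h e).flip.obj x) G)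
      fun s : Subobj (e.functor.obj x) => homπ _ G ⟨s.dom⟩ (inclElement e x s)) := by
  -- Unique factorization of regular maps through `Subobj` says exactly that `U(-, x)₊` is a free
  -- presheaf on `A` with generators the inclusions `inclElement e x s`.
  refine homObjIsLimit _ G (a := fun s : Subobj (e.functor.obj x) => ⟨s.dom⟩) (inclElement e x)
    (fun a γ hγ => ?_) (fun s a α => ?_) (fun s t a α β H => ?_)
  · obtain ⟨γ, hγ', rfl⟩ := exists_eq_toRegularSet hγ
    obtain ⟨s, α, H⟩ := Subobj.exists_comp_inclI hγ'
    exact ⟨s, α, (map_inclElement e x s α).trans (congrArg toRegularSet H)⟩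
  · rw [map_inclElement]
    exact toRegularSet_ne (isRegular_inclA_comp_inclI s α)
  · rw [map_inclElement, map_inclElement] at H
    exact Subobj.comp_inclI_inj (toRegularSet_inj (isRegular_inclA_comp_inclI s α) H)

/-- The unit is the transpose of the identity of `L F`. -/
lemma bimoduleAdjunction_unit_π [HasLimits C] [HasColimits C] {A B : Type v} [SmallCategory A]
    [SmallCategory B] (P : Aᵒᵖ ⥤ B ⥤ Pointed.{v}) (F : Bᵒᵖ ⥤ C) (b : B) (a : A)
    (s : (P.flip.obj b).obj (op a)) :
    ((bimoduleAdjunction P).unit.app F).app (op b) ≫ homπ (P.flip.obj b) _ a s =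
      tensorι F (P.obj (op a)) b s :=
  (bimoduleTranspose_π P (𝟙 ((bimoduleL P).obj F)) (op b) a s).trans (Category.comp_id _)

/-- The matrix entries of the unit of the adjunction at a free functor. -/
lemma copowerι_unit_π [HasLimits C] [HasColimits C] (b : B) (X : C) (x : B)
    (s t : Subobj (e.functor.obj x)) {γ : (⟨s.dom⟩ : ConjCat h) ⟶ e.functor.obj b}
    (hγ : IsRegular γ) :
    copowerι X (RegularSet (⟨s.dom⟩ : ConjCat h) (e.functor.obj b)) (toRegularSet γ) ≫
      copowerMap (𝟙 X) (restrictMap e x b s) ≫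
      ((bimoduleAdjunction (conjugatePairBimodule h e)).unit.app (freeFunctor b X)).app (op x) ≫
      homπ ((conjugatePairBimodule h e).flip.obj x) _ ⟨t.dom⟩ (inclElement e x t) =
    copowerι X (RegularSet (⟨t.dom⟩ : ConjCat h) (e.functor.obj b))
      (toRegularSet (inclI t.arrow t.arrow_mem ≫ restrict s.arrow s.arrow_mem ≫ γ)) ≫
      coyonedaMap b X ((conjugatePairBimodule h e).obj (op ⟨t.dom⟩)) := by
  rw [bimoduleAdjunction_unit_π, copowerι_map_assoc, Category.id_comp,
    restrictMap_toRegularSet e x b s hγ]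
  -- The summand of `γ` in `F(x)` is that of `γ ∘ s*`. Co-Yoneda applies this map to the element `t`
  -- of the bimodule, which yields the class of `γ ∘ s* ∘ t`.
  refine (copowerι_tensorι b X ((conjugatePairBimodule h e).obj (op ⟨t.dom⟩)) x _ (inclElement e x t)).trans ?_
  congr 2
  refine (regularMap_toRegularSet (h := h) (𝟙 (⟨t.dom⟩ : WideSubcategory A)) _
    (inclI t.arrow t.arrow_mem)).trans ?_
  rw [e.functor.map_preimage, CategoryTheory.Functor.map_id, Category.id_comp]
  rfl

lemma copower_regularSet_ext [HasColimits C] {X Y : C} {a b : ConjCat h}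
    {f g : copower X (RegularSet a b) ⟶ Y}
    (H : ∀ γ : a ⟶ b, IsRegular γ → copowerι X (RegularSet a b) (toRegularSet γ) ≫ f =
      copowerι X (RegularSet a b) (toRegularSet γ) ≫ g) : f = g := by
  refine copower_ext fun s => ?_
  by_cases hs : s = (RegularSet a b).point
  · rw [hs, copowerι_point, zero_comp, zero_comp]
  · obtain ⟨γ, hγ, rfl⟩ := exists_eq_toRegularSet hs
    exact H γ hγ

/-- Because `s* ∘ s = 1`, the diagonal entry is exactly the co-Yoneda isomorphism. -/
lemma isIso_unit_diagonal [HasLimits C] [HasColimits C] (b : B) (X : C) (x : B)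
    (s : Subobj (e.functor.obj x)) :
    IsIso (copowerMap (𝟙 X) (restrictMap e x b s) ≫
      ((bimoduleAdjunction (conjugatePairBimodule h e)).unit.app (freeFunctor b X)).app (op x) ≫
      homπ ((conjugatePairBimodule h e).flip.obj x) _ ⟨s.dom⟩ (inclElement e x s)) := by
  have H : copowerMap (𝟙 X) (restrictMap e x b s) ≫
      ((bimoduleAdjunction (conjugatePairBimodule h e)).unit.app (freeFunctor b X)).app (op x) ≫
      homπ ((conjugatePairBimodule h e).flip.obj x) _ ⟨s.dom⟩ (inclElement e x s) =
      coyonedaMap b X ((conjugatePairBimodule h e).obj (op ⟨s.dom⟩)) := by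
    refine copower_regularSet_ext fun γ hγ => ?_
    rw [copowerι_unit_π e b X x s s hγ, inclI_restrict_assoc]
  rw [H]
  exact isIso_coyonedaMap b X _

/-- If `γ ∘ s* ∘ t` were regular, so would be its first factor `s* ∘ t`, and `t` would factor
through `s`. Hence every summand goes to the basepoint. -/
lemma unit_eq_zero [HasLimits C] [HasColimits C] (b : B) (X : C) (x : B)
    (s t : Subobj (e.functor.obj x)) (hst : ¬ t ≤ s) :
    copowerMap (𝟙 X) (restrictMap e x b s) ≫
      ((bimoduleAdjunction (conjugatePairBimodule h e)).unit.app (freeFunctor b X)).app (op x) ≫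
      homπ ((conjugatePairBimodule h e).flip.obj x) _ ⟨t.dom⟩ (inclElement e x t) = 0 := by
  refine copower_regularSet_ext fun γ hγ => ?_
  rw [copowerι_unit_π e b X x s t hγ, toRegularSet_of_not, comp_zero]
  · exact ((copowerι_point X (RegularSet (⟨t.dom⟩ : ConjCat h) (e.functor.obj b))) =≫ _).trans
      zero_comp
  · rw [← Category.assoc]
    exact fun H => hst (Subobj.le_of_isRegular (isRegular_of_comp _ γ H))

end

end ConjCat

theorem mainTheorem4 {C : Type u} [Category.{v} C] [ModelCategory C] [HasLimits C] [HasColimits C]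
    [HasZeroObject C] [HasZeroMorphisms C] (hC : IsSemiStable C)
    {U : Type v} [SmallCategory U] {I A : MorphismProperty U}
    [I.IsMultiplicative] [A.IsMultiplicative] (h : AdmitsConjugation I A)
    {B : Type v} [SmallCategory B] (e : B ≌ ConjCat h)
    (b : B) (X : C) [IsCofibrant X] :
    (weakEquivalences C).functorCategory Bᵒᵖ
      ((bimoduleAdjunction (conjugatePairBimodule h e)).unit.app (freeFunctor b X)) := by
  intro x
  -- The triangular criterion needs cofibrant summands; each is a coproduct of copies of the
  -- cofibrant object `X`.
  have (s : ConjCat.Subobj (e.functor.obj x.unop)) :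
      IsCofibrant (copower X (ConjCat.RegularSet (⟨s.dom⟩ : ConjCat h) (e.functor.obj b))) :=
    isCofibrant_of_isColimit_cofan (coproductIsCoproduct _)
  exact (hC.weakEquivalence_of_triangular (ConjCat.freeFunctorIsColimit e b X x.unop)
    (ConjCat.bimoduleRIsLimit e _ x.unop) _ (ConjCat.isIso_unit_diagonal e b X x.unop)
    (ConjCat.unit_eq_zero e b X x.unop)).mem
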